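/- Consider the symmetric linear computation broadcast problem over $\mathbb F_q$, $q=p^n$ ($p$ prime), with $K\ge 1$ users and data dimension $d$. An instance $\Lambda$ consists of matrices $\mathbf v_k\in\mathbb F_q^{d\times m}$ (demands) and $\mathbf v'_k\in\mathbb F_q^{d\times m'}$ (side information), $k=1,\dots,K$. An achievable scheme consists of a batch size $L\ge1$, a finite alphabet $\mathcal S$, an encoder $\Phi:\mathbb F_q^{d\times L}\to\mathcal S$ and decoders $\Psi_k$ with $\Psi_k(\Phi(\mathbf x),\mathbf x^T\mathbf v_k')=\mathbf x^T\mathbf v_k$ for all $k$ and all $\mathbf x\in\mathbb F_q^{d\times L}$; its cost is $\log_q|\mathcal S|/L$, and $\Delta^*(\Lambda)$ is the infimum of the costs of the achievable schemes. Let $\Lambda_n$ be a uniformly random instance over $\mathbb F_{p^n}$. If $\Delta^*(\Lambda_n)$ converges in probability, as $n\to\infty$, to a constant $\Delta_g$, then we say that the generic capacity $C_g(p,K,d,m,m')=1/\Delta_g$ exists. Compare $C_g$ with the better of the two baseline rates $1/(d-m')$ (random coding) and $1/(Km)$ (separate transmissions), for integers $m\ge1$ and $0\le m'<d$. Put $$\rho(p,K,d,m,m')=\frac{C_g(p,K,d,m,m')}{\max\{\frac1{d-m'},\frac1{Km}\}},\qquad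 \tilde\rho(K,d,m,m')=\frac{\frac{m+m'}{md}}{\max\{\frac1{d-m'},\frac1{Km}\}}.$$ (1) For every $K\ge1$, the extremal gain as a function of the number of users is $$\eta_K=\sup_{p,d,m,m'}\rho(p,K,d,m,m')=\sup_{d,m,m'}\tilde\rho(K,d,m,m')=K,$$ where the first supremum is over all parameters for which $C_g$ exists. (2) For every $d\ge1$, let $\eta_d=\sup_{p,K,m,m'}\rho(p,K,d,m,m')$ be the extremal gain as a function of the data dimension, the supremum being over all parameters ($K\ge1$) for which $C_g$ exists. Then $\eta_d\ge d/4$ for every $d\ge 1$, and $\eta_d\in[d/4,\,d/4+1]$ for every $d\ge1$ other than $3$ and $7$; moreover $\eta_3=2$ and $\eta_7=3$. If the supremum is restricted to large numbers of users, $K\ge d/\gcd(d,m+m')$, then it lies in $[d/4,\,d/4+1]$ for every $d\ge1$. Likewise $\sup_{K,m,m'}\tilde\rho(K,d,m,m')\in[d/4,\,d/4+1]$ for every $d\ge1$. -/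

import Mathlib

open Filter Topology
open scoped ENNReal

namespace LCBC

noncomputable section

/-- A symmetric linear computation broadcast instance over the field `F`: `K` users and
`d`-dimensional data; user `k` wants `m` linear combinations of the data (the columns of
`demand k`) and already holds `m'` linear combinations of them (the columns of `side k`). -/
abbrev Inst (F : Type) (K d m m' : ℕ) : Type :=
  (Fin K → Matrix (Fin d) (Fin m) F) × (Fin K → Matrix (Fin d) (Fin m') F)

/-- The demand coefficient matrix `v_k` of user `k`. -/
def Inst.demand {F : Type} {K d m m' : ℕ} (I : Inst F K d m m') (k : Fin K) :
    Matrix (Fin d) (Fin m) F := I.1 k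

/-- The side-information coefficient matrix `v'_k` of user `k`. -/
def Inst.side {F : Type} {K d m m' : ℕ} (I : Inst F K d m m') (k : Fin K) :
    Matrix (Fin d) (Fin m') F := I.2 k

/-- An achievable coding scheme for an instance: a batch size `L ≥ 1`, a finite broadcast alphabet,
an arbitrary encoder, and arbitrary decoders, such that every user recovers its demand from the
broadcast symbol and its side information, for every realization `x` of the data. -/
structure Scheme {F : Type} [Field F] {K d m m' : ℕ} (I : Inst F K d m m') where
  L : ℕ
  L_pos : 0 < L
  Alphabet : Type
  fintypeAlphabet : Fintype Alphabet
  encode : Matrix (Fin d) (Fin L) F → Alphabet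
  decode : Fin K → Alphabet → Matrix (Fin L) (Fin m') F → Matrix (Fin L) (Fin m) F
  correct : ∀ (k : Fin K) (x : Matrix (Fin d) (Fin L) F),
    decode k (encode x) (x.transpose * I.side k) = x.transpose * I.demand k

/-- The broadcast cost `log_q |S| / L` of a scheme, where `q = |F|`. -/
def Scheme.cost {F : Type} [Field F] {K d m m' : ℕ} {I : Inst F K d m m'} (s : Scheme I) : ℝ :=
  Real.logb (Nat.card F) (Nat.card s.Alphabet) / s.L

/-- The optimal broadcast cost `Δ*` of an instance. -/
def optCost {F : Type} [Field F] {K d m m' : ℕ} (I : Inst F K d m m') : ℝ :=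
  sInf (Set.range fun s : Scheme I => s.cost)

/-- The probability that a uniformly random element of the finite type `α` satisfies `P`. -/
def prob (α : Type) (P : α → Prop) : ℝ :=
  (Nat.card {a : α // P a} : ℝ) / Nat.card α

/-- `Δ` is the generic optimal broadcast cost for the parameters `p, K, d, m, m'`: the optimal cost
of a uniformly random instance over the field with `p ^ n` elements converges to `Δ` in probability
as `n → ∞`. -/
def IsGenericCost (p : ℕ) [Fact p.Prime] (K d m m' : ℕ) (Δ : ℝ) : Prop :=
  ∀ ε : ℝ, 0 < ε →
    Tendsto (fun n : ℕ => prob (Inst (GaloisField p n) K d m m') fun I => |optCost I - Δ| < ε)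
      atTop (𝓝 1)

/-- `C` is the generic capacity (the reciprocal of the generic optimal broadcast cost,
with `1 / 0 = ∞`) for the parameters `p, K, d, m, m'`; in particular this says that it exists. -/
def IsGenericCapacity (p : ℕ) [Fact p.Prime] (K d m m' : ℕ) (C : ℝ≥0∞) : Prop :=
  ∃ Δ : ℝ, IsGenericCost p K d m m' Δ ∧ C = 1 / ENNReal.ofReal Δ

/-- The better of the rates of the two baseline schemes, random coding `1 / (d - m')⁺` and
separate transmissions `1 / (K m)` (with `1 / 0 = ∞`). The natural number subtraction is the
positive part. -/
def baselineRate (K d m m' : ℕ) : ℝ≥0∞ :=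
  max (1 / ((d - m' : ℕ) : ℝ≥0∞)) (1 / ((K : ℝ≥0∞) * m))

/-- The expression `(m + m') / (m d)`. -/
def envelopeRate (d m m' : ℕ) : ℝ≥0∞ :=
  ((m : ℝ≥0∞) + m') / ((m : ℝ≥0∞) * d)

/-- `K` users suffice for the large-number-of-users regime: `K ≥ d / gcd(d, m + m')`. -/
def ManyUsers (K d m m' : ℕ) : Prop := d / Nat.gcd d (m + m') ≤ K

/-- Extremal gain of the generic capacity over the baseline schemes as a function of `K`: the
supremum over all primes `p` and all `d, m, m'` with `m ≥ 1` and `m' < d` (so that the baseline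
rates are finite) for which the generic capacity exists. -/
def gainUsers (K : ℕ) : ℝ≥0∞ :=
  sSup {g | ∃ (p : ℕ) (_ : Fact p.Prime) (d m m' : ℕ) (C : ℝ≥0∞),
    0 < m ∧ m' < d ∧ IsGenericCapacity p K d m m' C ∧ g = C / baselineRate K d m m'}

/-- Extremal gain as a function of the data dimension `d`: the supremum over all primes `p` and
all `K ≥ 1`, `m ≥ 1`, `m' < d` for which the generic capacity exists. -/
def gainDim (d : ℕ) : ℝ≥0∞ :=
  sSup {g | ∃ (p : ℕ) (_ : Fact p.Prime) (K m m' : ℕ) (C : ℝ≥0∞),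
    0 < K ∧ 0 < m ∧ m' < d ∧ IsGenericCapacity p K d m m' C ∧ g = C / baselineRate K d m m'}

/-- As `gainDim`, with the supremum restricted to the large-number-of-users regime. -/
def gainDimManyUsers (d : ℕ) : ℝ≥0∞ :=
  sSup {g | ∃ (p : ℕ) (_ : Fact p.Prime) (K m m' : ℕ) (C : ℝ≥0∞),
    0 < K ∧ 0 < m ∧ m' < d ∧ ManyUsers K d m m' ∧ IsGenericCapacity p K d m m' C ∧
      g = C / baselineRate K d m m'}

/-- As `gainUsers`, with the generic capacity replaced by `(m + m') / (m d)`. -/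
def envelopeGainUsers (K : ℕ) : ℝ≥0∞ :=
  sSup {g | ∃ d m m' : ℕ, 0 < m ∧ m' < d ∧ g = envelopeRate d m m' / baselineRate K d m m'}

/-- As `gainDim`, with the generic capacity replaced by `(m + m') / (m d)`. -/
def envelopeGainDim (d : ℕ) : ℝ≥0∞ :=
  sSup {g | ∃ K m m' : ℕ, 0 < K ∧ 0 < m ∧ m' < d ∧
    g = envelopeRate d m m' / baselineRate K d m m'}

end

end LCBC

/-!
For a scheme with cost `c`, let `I(W)` be the mutual information, per data symbol, between the
broadcast and the combinations of the data with coefficient vectors in a subspace `W` of `F ^ d`.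
It is supermodular in `W` and at most `c`, and it is at least `dim W - m'` for the span `W` of the
demand and side information of one user. The spans of the users of a random instance are in general
position, so by intersecting and adding supermodularity trades `k` of them for `c'` copies of the
whole space if `k * min d (m + m') ≤ c' * d`; hence `k * (min d (m + m') - m') ≤ c' * Δ` for a
generic cost `Δ`.

Two families of parameters show that this is sharp. For `m = 1`, `K = r + 1`, `d = (r + 1) * r + 1`
and `m' = r ^ 2`, the spans of all users share a vector outside of their side information, and
broadcasting that single combination gives `Δ = 1`. For `m = 1` and `K ≥ d`, interference alignment
over the prime field gives `Δ = d / (m' + 1)`: modulo its side information, the demand of a random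
user has `m' + 1` multiples with independent uniform coordinates, and multiplication by any of these
coordinates maps the span of the monomials of degree less than `N` in each of them to that of the
monomials of degree less than `N + 1`, which has asymptotically the same dimension.

With `a = m + m'`, the gain is thus at most about `(d + 1 - a) * a / d`, which is maximal for `a`
near `d / 2`. As `k` and `c'` are integers, the resulting bound exceeds `d / 4 + 1` for `d = 3` and
`d = 7`, where the first family attains it.
-/

namespace LCBC

noncomputable section

/-! ### Equivocation of an equivalence relation -/

section Equivocation

open scoped BigOperators

variable {X : Type*} [Fintype X]

open Classical in
/-- The size of the equivalence class of `x`. -/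
def classCard (r : Setoid X) (x : X) : ℕ := (Finset.univ.filter fun y => r x y).card

/-- The conditional entropy, in nats, of a uniformly random point given its equivalence class:
an observer who only sees the class of `x` is left with `classCard r x` equally likely points. -/
def equivocation (r : Setoid X) : ℝ := 𝔼 x, Real.log (classCard r x)

theorem classCard_pos (r : Setoid X) (x : X) : 0 < classCard r x :=
  Finset.card_pos.2 ⟨x, by simp⟩

theorem classCard_eq_of_rel {r : Setoid X} {x y : X} (h : r x y) :
    classCard r x = classCard r y := by
  classical
  refine congrArg Finset.card (Finset.filter_congr fun z _ => ?_)
  exact ⟨r.trans' (r.symm' h), r.trans' h⟩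

theorem classCard_mono {r s : Setoid X} (h : r ≤ s) (x : X) : classCard r x ≤ classCard s x := by
  classical
  exact Finset.card_le_card <| Finset.monotone_filter_right _ fun _ _ hy => h hy

theorem sum_inv_classCard_le_one {r : Setoid X} (s : Finset X) (hs : ∀ x ∈ s, ∀ y ∈ s, r x y) :
    ∑ x ∈ s, (classCard r x : ℝ)⁻¹ ≤ 1 := by
  classical
  obtain rfl | ⟨y, hy⟩ := s.eq_empty_or_nonempty
  · simp
  have hcard : s.card ≤ classCard r y := Finset.card_le_card fun x hx => by simp [hs y hy x hx]
  calc ∑ x ∈ s, (classCard r x : ℝ)⁻¹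
      = ∑ _x ∈ s, (classCard r y : ℝ)⁻¹ :=
        Finset.sum_congr rfl fun x hx => by rw [classCard_eq_of_rel (hs x hx y hy)]
    _ = s.card / classCard r y := by rw [Finset.sum_const, nsmul_eq_mul, div_eq_mul_inv]
    _ ≤ 1 := div_le_one_of_le₀ (mod_cast hcard) (by positivity)

theorem equivocation_mono {r s : Setoid X} (h : r ≤ s) : equivocation r ≤ equivocation s :=
  Finset.expect_le_expect fun x _ =>
    Real.log_le_log (mod_cast classCard_pos r x) (mod_cast classCard_mono h x)

theorem equivocation_bot : equivocation (⊥ : Setoid X) = 0 := by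
  classical
  have hcard (x : X) : classCard (⊥ : Setoid X) x = 1 :=
    Finset.card_eq_one.2 ⟨x, by ext y; simp [eq_comm]⟩
  simp [equivocation, hcard]

theorem equivocation_top [Nonempty X] :
    equivocation (⊤ : Setoid X) = Real.log (Fintype.card X) := by
  simp [equivocation, classCard, Setoid.top_def]

theorem expect_log_nonpos {f : X → ℝ} (hf : ∀ x, 0 < f x) (h : 𝔼 x, f x ≤ 1) :
    𝔼 x, Real.log (f x) ≤ 0 := by
  cases isEmpty_or_nonempty X
  · simp
  calc 𝔼 x, Real.log (f x)
      ≤ 𝔼 x, (f x - 1) := Finset.expect_le_expect fun x _ => Real.log_le_sub_one_of_pos (hf x)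
    _ = 𝔼 x, f x - 1 := by rw [Finset.expect_sub_distrib, Fintype.expect_const]
    _ ≤ 0 := sub_nonpos.2 h

/-- Given `x`, choose `y` in its `a`-class and `z` in its `b`-class. Conversely, a pair `y, z` of
`c`-related points determines the possible `x` up to `a ⊓ b`. -/
theorem sum_classCard_mul_div_le {a b c : Setoid X} (hac : a ≤ c) (hbc : b ≤ c) :
    ∑ x, (classCard a x * classCard b x / (classCard (a ⊓ b) x * classCard c x) : ℝ) ≤
      Fintype.card X := by
  classical
  let cls (r : Setoid X) (x : X) : Finset X := {y | r x y}
  let w (x : X) : ℝ := ((classCard (a ⊓ b) x : ℝ) * classCard c x)⁻¹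
  have swap : ∑ x, ∑ _yz ∈ cls a x ×ˢ cls b x, w x =
      ∑ yz ∈ Finset.univ.filter fun yz : X × X => c yz.1 yz.2,
        ∑ x with a x yz.1 ∧ b x yz.2, w x :=
    Finset.sum_comm' fun x yz => by
      simp only [cls, Finset.mem_univ, true_and, Finset.mem_product, Finset.mem_filter,
        iff_self_and]
      exact fun h => c.trans' (c.symm' (hac h.1)) (hbc h.2)
  have inner (y z : X) : ∑ x with a x y ∧ b x z, w x ≤ (classCard c y : ℝ)⁻¹ := by
    calc ∑ x with a x y ∧ b x z, w x
        = (∑ x with a x y ∧ b x z, (classCard (a ⊓ b) x : ℝ)⁻¹) * (classCard c y : ℝ)⁻¹ := by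
          rw [Finset.sum_mul]
          refine Finset.sum_congr rfl fun x hx => ?_
          rw [← classCard_eq_of_rel (hac (Finset.mem_filter.1 hx).2.1), ← mul_inv]
      _ ≤ (classCard c y : ℝ)⁻¹ := by
          refine mul_le_of_le_one_left (by positivity) (sum_inv_classCard_le_one _ ?_)
          simp only [Finset.mem_filter, Finset.mem_univ, true_and]
          exact fun x hx x' hx' =>
            ⟨a.trans' hx.1 (a.symm' hx'.1), b.trans' hx.2 (b.symm' hx'.2)⟩
  calc ∑ x, (classCard a x * classCard b x / (classCard (a ⊓ b) x * classCard c x) : ℝ)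
      = ∑ x, ∑ _yz ∈ cls a x ×ˢ cls b x, w x := by
        simp [cls, w, classCard, div_eq_mul_inv]
    _ ≤ ∑ yz ∈ Finset.univ.filter fun yz : X × X => c yz.1 yz.2, (classCard c yz.1 : ℝ)⁻¹ :=
        swap.trans_le (Finset.sum_le_sum fun yz _ => inner yz.1 yz.2)
    _ = ∑ y, (classCard c y : ℝ) * (classCard c y : ℝ)⁻¹ := by
        rw [Finset.sum_filter, Fintype.sum_prod_type]
        simp only [← Finset.sum_filter, Finset.sum_const, nsmul_eq_mul, classCard]
    _ = Fintype.card X := by simp [(classCard_pos c _).ne']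

theorem equivocation_submodular {a b c : Setoid X} (hac : a ≤ c) (hbc : b ≤ c) :
    equivocation a + equivocation b ≤ equivocation (a ⊓ b) + equivocation c := by
  have hpos (r : Setoid X) (x : X) : (0 : ℝ) < classCard r x := mod_cast classCard_pos r x
  have hratio :=
    expect_log_nonpos (f := fun x => classCard a x * classCard b x /
        (classCard (a ⊓ b) x * classCard c x))
      (fun x => div_pos (mul_pos (hpos a x) (hpos b x)) (mul_pos (hpos _ x) (hpos c x)))
      ((Fintype.expect_eq_sum_div_card _).trans_le
        (div_le_one_of_le₀ (sum_classCard_mul_div_le hac hbc) (by positivity)))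
  rw [← sub_nonpos]
  simp only [equivocation, ← Finset.expect_add_distrib, ← Finset.expect_sub_distrib]
  convert hratio using 2 with x
  rw [Real.log_div (mul_pos (hpos a x) (hpos b x)).ne' (mul_pos (hpos _ x) (hpos c x)).ne',
    Real.log_mul (hpos a x).ne' (hpos b x).ne', Real.log_mul (hpos _ x).ne' (hpos c x).ne']

theorem log_card_sub_log_card_le_equivocation_ker [Nonempty X] {S : Type*} [Fintype S]
    (g : X → S) :
    Real.log (Fintype.card X) - Real.log (Fintype.card S) ≤ equivocation (Setoid.ker g) := by
  classical
  have hX : (0 : ℝ) < Fintype.card X := mod_cast Fintype.card_pos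
  have hS : (0 : ℝ) < Fintype.card S := by
    have : Nonempty S := ‹Nonempty X›.map g
    exact mod_cast Fintype.card_pos
  have hpos (x : X) : (0 : ℝ) < classCard (Setoid.ker g) x := mod_cast classCard_pos _ x
  have hfibres : ∑ x, (classCard (Setoid.ker g) x : ℝ)⁻¹ ≤ Fintype.card S := by
    rw [← Finset.sum_fiberwise Finset.univ g]
    calc _ ≤ ∑ _s : S, (1 : ℝ) := Finset.sum_le_sum fun s _ =>
          sum_inv_classCard_le_one _ fun x hx y hy => Setoid.ker_def.2 <|
            (Finset.mem_filter.1 hx).2.trans (Finset.mem_filter.1 hy).2.symm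
      _ = Fintype.card S := by simp
  have hmean : 𝔼 x, Fintype.card X / Fintype.card S * (classCard (Setoid.ker g) x : ℝ)⁻¹ ≤ 1 := by
    rw [Fintype.expect_eq_sum_div_card, ← Finset.mul_sum]
    calc _ ≤ Fintype.card X / Fintype.card S * Fintype.card S / (Fintype.card X : ℝ) := by gcongr
      _ = 1 := by field_simp
  have hlog := expect_log_nonpos (fun x => by have := hpos x; positivity) hmean
  rw [← sub_nonpos, ← Fintype.expect_const (ι := X) (Real.log _ - Real.log _), equivocation,
    ← Finset.expect_sub_distrib]
  convert hlog using 2 with x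
  rw [Real.log_mul (by positivity) (inv_pos.2 (hpos x)).ne', Real.log_div hX.ne' hS.ne',
    Real.log_inv, sub_eq_add_neg]

end Equivocation

/-! ### Linear observations of a matrix -/

section Observation

open scoped Matrix

variable {ι κ ν R : Type*} [Fintype ι] [CommSemiring R]

/-- The information that a user knowing the linear combinations of the data with coefficient vectors
in `W` has about it: two data matrices, whose rows are indexed by the coordinates in `ι` and whose
columns are indexed by the batch `κ`, are identified if all these combinations agree. -/
def obs (κ : Type*) (W : Submodule R (ι → R)) : Setoid (Matrix ι κ R) :=
  Setoid.ker fun x => x.vecMulLinear.domRestrict W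

/-- The column space of a matrix. -/
def colSpan (M : Matrix ι ν R) : Submodule R (ι → R) := Submodule.span R (Set.range M.col)

theorem obs_iff_le_eqLocus {W : Submodule R (ι → R)} {x y : Matrix ι κ R} :
    obs κ W x y ↔ W ≤ LinearMap.eqLocus x.vecMulLinear y.vecMulLinear :=
  Setoid.ker_def.trans <| LinearMap.ext_iff.trans <| Subtype.forall

theorem obs_anti {A B : Submodule R (ι → R)} (h : A ≤ B) : obs κ B ≤ obs κ A :=
  fun _ _ hxy => obs_iff_le_eqLocus.2 (h.trans (obs_iff_le_eqLocus.1 hxy))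

theorem obs_sup (A B : Submodule R (ι → R)) : obs κ (A ⊔ B) = obs κ A ⊓ obs κ B :=
  Setoid.ext fun x y => by
    rw [Setoid.inf_iff_and, obs_iff_le_eqLocus, obs_iff_le_eqLocus, obs_iff_le_eqLocus, sup_le_iff]

theorem obs_bot : obs κ (⊥ : Submodule R (ι → R)) = ⊤ :=
  eq_top_iff.2 fun _ _ _ => obs_iff_le_eqLocus.2 bot_le

theorem obs_top : obs κ (⊤ : Submodule R (ι → R)) = ⊥ := by
  classical
  refine eq_bot_iff.2 fun {x y} h => ?_
  ext i j
  simpa using congrFun (obs_iff_le_eqLocus.1 h (Submodule.mem_top (x := Pi.single i 1))) j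

theorem obs_colSpan {M : Matrix ι ν R} {x y : Matrix ι κ R} :
    obs κ (colSpan M) x y ↔ xᵀ * M = yᵀ * M := by
  rw [obs_iff_le_eqLocus, colSpan, Submodule.span_le, Set.range_subset_iff, ← Matrix.ext_iff,
    forall_comm]
  refine forall_congr' fun j => funext_iff.trans <| forall_congr' fun i => ?_
  rw [Matrix.vecMulLinear_apply, Matrix.vecMulLinear_apply, ← Matrix.mulVec_transpose,
    ← Matrix.mulVec_transpose]
  rfl

end Observation

section CardObservation

variable {ι κ F : Type*} [Fintype ι] [Field F] [Fintype F]

theorem card_orthogonal (W : Submodule F (ι → F)) :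
    Nat.card {u : ι → F // ∀ w ∈ W, w ⬝ᵥ u = 0} =
      Fintype.card F ^ (Fintype.card ι - Module.finrank F W) := by
  classical
  have e : {u : ι → F // ∀ w ∈ W, w ⬝ᵥ u = 0} ≃ W.dualAnnihilator :=
    (dotProductEquiv F ι).toEquiv.subtypeEquiv fun u => by
      simp [Submodule.mem_dualAnnihilator, dotProductEquiv, dotProduct_comm]
  have hdim := Subspace.finrank_add_finrank_dualAnnihilator_eq W
  rw [Module.finrank_fintype_fun_eq_card] at hdim
  rw [Nat.card_congr e, Module.natCard_eq_pow_finrank (K := F), Nat.card_eq_fintype_card,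
    ← Nat.eq_sub_of_add_eq' hdim]

variable [Fintype κ] [DecidableEq ι] [DecidableEq κ]

theorem classCard_obs (W : Submodule F (ι → F)) (x : Matrix ι κ F) :
    classCard (obs κ W) x =
      Fintype.card F ^ (Fintype.card κ * (Fintype.card ι - Module.finrank F W)) := by
  classical
  have e : {y // obs κ W x y} ≃ (κ → {u : ι → F // ∀ w ∈ W, w ⬝ᵥ u = 0}) :=
    (((Equiv.subRight x).trans (Equiv.piComm fun _ _ => F)).subtypeEquiv fun y => by
      simp only [obs_iff_le_eqLocus, SetLike.le_def, LinearMap.mem_eqLocus, funext_iff,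
        Matrix.vecMulLinear_apply]
      exact ⟨fun h j w hw => (dotProduct_sub w (y.col j) (x.col j)).trans
          (sub_eq_zero.2 (h hw j).symm),
        fun h w hw j => (sub_eq_zero.1 ((dotProduct_sub w (y.col j) (x.col j)).symm.trans
          (h j w hw))).symm⟩).trans Equiv.subtypePiEquivPi
  have hclass : classCard (obs κ W) x = Nat.card {y // obs κ W x y} := by
    rw [Nat.card_eq_fintype_card, Fintype.card_subtype, classCard]
  rw [hclass, Nat.card_congr e, Nat.card_pi]
  simp only [card_orthogonal, Finset.prod_const, Finset.card_univ]
  rw [← pow_mul, mul_comm]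

theorem equivocation_obs (W : Submodule F (ι → F)) :
    equivocation (obs κ W) =
      Fintype.card κ * ((Fintype.card ι - Module.finrank F W) * Real.log (Fintype.card F)) := by
  have hle : Module.finrank F W ≤ Fintype.card ι := by simpa using Submodule.finrank_le W
  simp only [equivocation, classCard_obs, Fintype.expect_const]
  rw [Nat.cast_pow, Real.log_pow, Nat.cast_mul, Nat.cast_sub hle, mul_assoc]

end CardObservation

/-! ### Supermodular functions on subspaces in general position -/

section Transversal

/-- General position of two elements of a lattice of subspaces: they meet trivially or they span
everything. -/
def Transversal {α : Type*} [Lattice α] [BoundedOrder α] (a b : α) : Prop :=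
  Disjoint a b ∨ Codisjoint a b

open Classical in
/-- The running element obtained from a sequence by intersecting with the next member if this
member completes it to everything, and joining the next member otherwise. For subspaces in general
position its dimension is that of the members so far, reduced modulo the whole dimension. -/
def chain {α : Type*} [Lattice α] [BoundedOrder α] (U : ℕ → α) : ℕ → α
  | 0 => ⊥
  | j + 1 => if Codisjoint (chain U j) (U j) then chain U j ⊓ U j else chain U j ⊔ U j

theorem chain_congr {α : Type*} [Lattice α] [BoundedOrder α] {U U' : ℕ → α} {j : ℕ}
    (h : ∀ i < j, U i = U' i) : chain U j = chain U' j := by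
  induction j with
  | zero => rfl
  | succ j ih =>
    rw [chain, chain, ih fun i hi => h i (hi.trans j.lt_succ_self), h j j.lt_succ_self]

variable {F V : Type*} [DivisionRing F] [AddCommGroup V] [Module F V] [FiniteDimensional F V]

theorem transversal_of_finrank_sup {A B : Submodule F V} {r : ℕ} (hB : Module.finrank F B ≤ r)
    (h : Module.finrank F ↥(A ⊔ B) = min (Module.finrank F V) (Module.finrank F A + r)) :
    Transversal A B := by
  obtain hr | hr := le_total (Module.finrank F V) (Module.finrank F A + r)
  · exact .inr (codisjoint_iff.2 (Submodule.eq_top_of_finrank_eq (h.trans (min_eq_left hr))))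
  · refine .inl (disjoint_iff.2 (Submodule.finrank_eq_zero.1 ?_))
    have := Submodule.finrank_sup_add_finrank_inf_eq A B
    omega

theorem Transversal.codisjoint {A B : Submodule F V} (h : Transversal A B)
    (hd : Module.finrank F V ≤ Module.finrank F A + Module.finrank F B) : Codisjoint A B := by
  refine h.elim (fun hdisj => codisjoint_iff.2 (Submodule.eq_top_of_finrank_eq ?_)) id
  have hsum := Submodule.finrank_sup_add_finrank_inf_eq A B
  rw [hdisj.eq_bot, finrank_bot, add_zero] at hsum
  exact le_antisymm (Submodule.finrank_le _) (hd.trans_eq hsum.symm)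

theorem Transversal.disjoint {A B : Submodule F V} (h : Transversal A B)
    (hd : Module.finrank F A + Module.finrank F B ≤ Module.finrank F V) : Disjoint A B := by
  refine h.elim id fun hcodisj => disjoint_iff.2 (Submodule.finrank_eq_zero.1 ?_)
  have hsum := Submodule.finrank_sup_add_finrank_inf_eq A B
  rw [hcodisj.eq_top, finrank_top] at hsum
  omega

variable {f : Submodule F V → ℝ} {U : ℕ → Submodule F V} {k : ℕ}

theorem exists_sum_le_of_transversal (hf : ∀ A B, f A + f B ≤ f (A ⊔ B) + f (A ⊓ B))
    (hbot : f ⊥ = 0) (hU : ∀ i < k, Transversal (chain U i) (U i)) :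
    ∃ a : ℕ, ∑ i ∈ Finset.range k, Module.finrank F (U i) =
        a * Module.finrank F V + Module.finrank F ↥(chain U k) ∧
      ∑ i ∈ Finset.range k, f (U i) ≤ a * f ⊤ + f (chain U k) := by
  induction k with
  | zero => exact ⟨0, by rw [chain, finrank_bot]; simp, by simp [chain, hbot]⟩
  | succ k ih =>
    obtain ⟨a, hdim, hsum⟩ := ih fun i hi => hU i (hi.trans k.lt_succ_self)
    have hmod := Submodule.finrank_sup_add_finrank_inf_eq (chain U k) (U k)
    have hsuper := hf (chain U k) (U k)
    rw [Finset.sum_range_succ, Finset.sum_range_succ, chain, hdim]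
    by_cases hspan : Codisjoint (chain U k) (U k)
    · rw [hspan.eq_top, finrank_top] at hmod
      rw [hspan.eq_top] at hsuper
      rw [if_pos hspan]
      exact ⟨a + 1, by rw [add_mul]; omega, by push_cast; linarith⟩
    · have hdisj := (hU k k.lt_succ_self).resolve_right hspan
      rw [hdisj.eq_bot, finrank_bot] at hmod
      rw [hdisj.eq_bot, hbot] at hsuper
      rw [if_neg hspan]
      exact ⟨a, by omega, by linarith⟩

theorem sum_le_mul_top_of_transversal (hf : ∀ A B, f A + f B ≤ f (A ⊔ B) + f (A ⊓ B))
    (hbot : f ⊥ = 0) (htop : ∀ A, f A ≤ f ⊤) (hU : ∀ i < k, Transversal (chain U i) (U i))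
    {c : ℕ} (hc : ∑ i ∈ Finset.range k, Module.finrank F (U i) ≤ c * Module.finrank F V) :
    ∑ i ∈ Finset.range k, f (U i) ≤ c * f ⊤ := by
  obtain ⟨a, hdim, hsum⟩ := exists_sum_le_of_transversal hf hbot hU
  have hnonneg : 0 ≤ f ⊤ := hbot ▸ htop ⊥
  obtain hac | hca := lt_or_ge a c
  · have : (a : ℝ) + 1 ≤ c := mod_cast hac
    nlinarith [htop (chain U k)]
  · have hmul : c * Module.finrank F V ≤ a * Module.finrank F V := Nat.mul_le_mul_right _ hca
    have hchain : chain U k = ⊥ := Submodule.finrank_eq_zero.1 (by omega)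
    rw [hchain, hbot, add_zero] at hsum
    obtain hV | hV := (Module.finrank F V).eq_zero_or_pos
    · have : f ⊤ = 0 :=
        (congrArg f (Submodule.finrank_eq_zero.1 ((finrank_top F V).trans hV))).trans hbot
      simpa [this] using hsum
    · have : a = c := le_antisymm (Nat.le_of_mul_le_mul_right (by omega) hV) hca
      exact this ▸ hsum

end Transversal

/-! ### Information revealed by a scheme -/

section SideInformation

variable {F : Type} [Field F] {K d m m' : ℕ}

/-- The coefficient vectors of all combinations of the data that user `k` knows after decoding. -/
def Inst.userSpan (I : Inst F K d m m') (k : Fin K) : Submodule F (Fin d → F) :=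
  colSpan (I.demand k) ⊔ colSpan (I.side k)

/-- The subspaces `Inst.userSpan` as an infinite sequence, extended by `⊥` beyond the last user. -/
def Inst.userSeq (I : Inst F K d m m') (i : ℕ) : Submodule F (Fin d → F) :=
  if h : i < K then I.userSpan ⟨i, h⟩ else ⊥

theorem Inst.userSeq_of_lt (I : Inst F K d m m') {i : ℕ} (h : i < K) :
    I.userSeq i = I.userSpan ⟨i, h⟩ := dif_pos h

theorem finrank_colSpan_le {ν : Type*} [Fintype ν] (M : Matrix (Fin d) ν F) :
    Module.finrank F (colSpan M) ≤ Fintype.card ν := finrank_range_le_card M.col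

variable {I : Inst F K d m m'} (s : Scheme I)

theorem Scheme.ker_encode_inf_obs_userSpan (k : Fin K) :
    Setoid.ker s.encode ⊓ obs (Fin s.L) (I.userSpan k) =
      Setoid.ker s.encode ⊓ obs (Fin s.L) (colSpan (I.side k)) := by
  refine le_antisymm (inf_le_inf_left _ (obs_anti le_sup_right)) ?_
  rintro x y ⟨hencode, hside⟩
  refine ⟨hencode, ?_⟩
  rw [Inst.userSpan, obs_sup]
  refine ⟨obs_colSpan.2 ?_, hside⟩
  rw [← s.correct k x, ← s.correct k y, Setoid.ker_def.1 hencode, obs_colSpan.1 hside]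

end SideInformation

section Information

variable {F : Type} [Field F] [Fintype F] {K d m m' : ℕ} {I : Inst F K d m m'} (s : Scheme I)

/-- The mutual information between the broadcast symbol and the combinations of the data with
coefficient vectors in `W`, for uniformly distributed data; the unit is a field element for each of
the `L` instances of the batch, as for `Scheme.cost`. -/
def Scheme.info (W : Submodule F (Fin d → F)) : ℝ :=
  (equivocation (Setoid.ker s.encode ⊓ obs (Fin s.L) W) - equivocation (Setoid.ker s.encode)) /
    (s.L * Real.log (Fintype.card F)) + Module.finrank F W

theorem Scheme.batch_mul_log_pos : 0 < s.L * Real.log (Fintype.card F) :=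
  mul_pos (mod_cast s.L_pos) (Real.log_pos (mod_cast Fintype.one_lt_card))

theorem Scheme.equivocation_obs_div (W : Submodule F (Fin d → F)) :
    equivocation (obs (Fin s.L) W) / (s.L * Real.log (Fintype.card F)) =
      d - Module.finrank F W := by
  rw [equivocation_obs, div_eq_iff s.batch_mul_log_pos.ne', Fintype.card_fin, Fintype.card_fin]
  ring

theorem Scheme.info_bot : s.info ⊥ = 0 := by simp [Scheme.info, obs_bot]

theorem Scheme.info_top :
    s.info ⊤ = d - equivocation (Setoid.ker s.encode) / (s.L * Real.log (Fintype.card F)) := by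
  rw [Scheme.info, obs_top, inf_bot_eq, equivocation_bot, finrank_top,
    Module.finrank_fintype_fun_eq_card, Fintype.card_fin]
  ring

theorem Scheme.info_supermodular (A B : Submodule F (Fin d → F)) :
    s.info A + s.info B ≤ s.info (A ⊔ B) + s.info (A ⊓ B) := by
  have hsub := equivocation_submodular
    (inf_le_inf_left (Setoid.ker s.encode) (obs_anti (κ := Fin s.L) (inf_le_left : A ⊓ B ≤ A)))
    (inf_le_inf_left (Setoid.ker s.encode) (obs_anti (κ := Fin s.L) (inf_le_right : A ⊓ B ≤ B)))
  rw [← inf_inf_distrib_left, ← obs_sup] at hsub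
  have hdim : (Module.finrank F ↥(A ⊔ B) : ℝ) + Module.finrank F ↥(A ⊓ B) =
      Module.finrank F A + Module.finrank F B :=
    mod_cast Submodule.finrank_sup_add_finrank_inf_eq A B
  have hdiv := div_le_div_of_nonneg_right hsub s.batch_mul_log_pos.le
  rw [add_div, add_div] at hdiv
  simp only [Scheme.info, sub_div]
  linarith

theorem Scheme.info_le_top (W : Submodule F (Fin d → F)) : s.info W ≤ s.info ⊤ := by
  have hmono := div_le_div_of_nonneg_right
    (equivocation_mono (inf_le_right : Setoid.ker s.encode ⊓ obs (Fin s.L) W ≤ _))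
    s.batch_mul_log_pos.le
  rw [s.equivocation_obs_div] at hmono
  rw [s.info_top, Scheme.info, sub_div]
  linarith

theorem Scheme.info_nonneg (W : Submodule F (Fin d → F)) : 0 ≤ s.info W := by
  have hsub := equivocation_submodular (le_top : Setoid.ker s.encode ≤ ⊤)
    (le_top : obs (Fin s.L) W ≤ ⊤)
  have hdiv := div_le_div_of_nonneg_right hsub s.batch_mul_log_pos.le
  rw [← obs_bot, add_div, add_div, s.equivocation_obs_div, s.equivocation_obs_div, finrank_bot]
    at hdiv
  rw [Scheme.info, sub_div]
  push_cast at hdiv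
  linarith

theorem Scheme.finrank_sub_le_info_userSpan (k : Fin K) :
    (Module.finrank F (I.userSpan k) : ℝ) - m' ≤ s.info (I.userSpan k) := by
  have hside := s.info_nonneg (colSpan (I.side k))
  have hrank : (Module.finrank F (colSpan (I.side k)) : ℝ) ≤ m' := by
    simpa using finrank_colSpan_le (I.side k)
  rw [Scheme.info] at hside ⊢
  rw [s.ker_encode_inf_obs_userSpan k]
  linarith

theorem Scheme.info_top_le_cost : s.info ⊤ ≤ s.cost := by
  have := s.fintypeAlphabet
  have hker := div_le_div_of_nonneg_right (log_card_sub_log_card_le_equivocation_ker s.encode)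
    s.batch_mul_log_pos.le
  rw [← equivocation_top, ← obs_bot, sub_div, s.equivocation_obs_div, finrank_bot,
    Nat.cast_zero, sub_zero] at hker
  have hcost : s.cost = Real.log (Fintype.card s.Alphabet) / (s.L * Real.log (Fintype.card F)) := by
    rw [Scheme.cost, Real.logb, Nat.card_eq_fintype_card, Nat.card_eq_fintype_card, div_div,
      mul_comm (Real.log _)]
  rw [s.info_top, hcost]
  linarith

end Information

/-! ### Bounds for the optimal cost of an instance -/

section OptCost

open scoped Matrix

variable {F : Type} [Field F] {K d m m' : ℕ} {I : Inst F K d m m'}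

open Classical in
/-- The scheme of an encoder that, together with the side information, determines the demands. -/
def Scheme.ofEncode (L : ℕ) (hL : 0 < L) (S : Type) [Fintype S]
    (Φ : Matrix (Fin d) (Fin L) F → S)
    (hΦ : ∀ k x y, Φ x = Φ y → xᵀ * I.side k = yᵀ * I.side k →
      xᵀ * I.demand k = yᵀ * I.demand k) : Scheme I where
  L := L
  L_pos := hL
  Alphabet := S
  fintypeAlphabet := inferInstance
  encode := Φ
  decode k a y :=
    if hx : ∃ x, Φ x = a ∧ xᵀ * I.side k = y then hx.chooseᵀ * I.demand k else 0
  correct k x := by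
    have hx : ∃ x', Φ x' = Φ x ∧ x'ᵀ * I.side k = xᵀ * I.side k := ⟨x, rfl, rfl⟩
    rw [dif_pos hx]
    exact hΦ k _ _ hx.choose_spec.1 hx.choose_spec.2

variable [Finite F]

instance : Nonempty (Scheme I) :=
  have := Fintype.ofFinite (Matrix (Fin d) (Fin 1) F)
  ⟨Scheme.ofEncode 1 one_pos (Matrix (Fin d) (Fin 1) F) id
    fun k _ _ hxy _ => congrArg (fun z => zᵀ * I.demand k) hxy⟩

theorem Scheme.cost_nonneg (s : Scheme I) : 0 ≤ s.cost := by
  have := s.fintypeAlphabet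
  have : Nonempty s.Alphabet := ⟨s.encode 0⟩
  exact div_nonneg (Real.logb_nonneg (mod_cast Finite.one_lt_card) (mod_cast Nat.card_pos))
    (Nat.cast_nonneg _)

theorem optCost_le (s : Scheme I) : optCost I ≤ s.cost :=
  csInf_le ⟨0, Set.forall_mem_range.2 Scheme.cost_nonneg⟩ ⟨s, rfl⟩

theorem sum_finrank_userSeq_sub_le_mul_optCost {k c : ℕ} (hk : k ≤ K)
    (htrans : ∀ i < k, Transversal (chain I.userSeq i) (I.userSeq i))
    (hc : ∑ i ∈ Finset.range k, Module.finrank F (I.userSeq i) ≤ c * d) :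
    ∑ i ∈ Finset.range k, ((Module.finrank F (I.userSeq i) : ℝ) - m') ≤ c * optCost I := by
  have := Fintype.ofFinite F
  have hcost (s : Scheme I) :
      ∑ i ∈ Finset.range k, ((Module.finrank F (I.userSeq i) : ℝ) - m') ≤ c * s.cost := by
    calc ∑ i ∈ Finset.range k, ((Module.finrank F (I.userSeq i) : ℝ) - m')
        ≤ ∑ i ∈ Finset.range k, s.info (I.userSeq i) := Finset.sum_le_sum fun i hi => by
          rw [I.userSeq_of_lt ((Finset.mem_range.1 hi).trans_le hk)]
          exact s.finrank_sub_le_info_userSpan _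
      _ ≤ c * s.info ⊤ := sum_le_mul_top_of_transversal s.info_supermodular s.info_bot
          s.info_le_top htrans (by simpa using hc)
      _ ≤ c * s.cost := by gcongr; exact s.info_top_le_cost
  exact (le_ciInf hcost).trans_eq (Real.mul_iInf_of_nonneg c.cast_nonneg _).symm

theorem optCost_le_of_linearMap {E : Type*} [Field E] [Algebra E F] {W : Type} [AddCommGroup W]
    [Module E W] [FiniteDimensional E W] (φ : (Fin d → F) →ₗ[E] W)
    (hφ : ∀ k δ, φ δ = 0 → δ ᵥ* I.side k = 0 → δ ᵥ* I.demand k = 0) :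
    optCost I ≤ Module.finrank E W / Module.finrank E F := by
  have : Finite E := Finite.of_injective _ (algebraMap E F).injective
  have : Finite W := Module.finite_of_finite E
  have := Fintype.ofFinite W
  have hcol {n : ℕ} (x y : Matrix (Fin d) (Fin 1) F) (M : Matrix (Fin d) (Fin n) F) :
      xᵀ * M = yᵀ * M ↔ (x.col 0 - y.col 0) ᵥ* M = 0 := by
    rw [Matrix.sub_vecMul, sub_eq_zero]
    exact ⟨fun h => congrFun h 0, fun h => funext fun i => by rwa [Subsingleton.elim i 0]⟩
  let s : Scheme I := Scheme.ofEncode 1 one_pos W (fun x => φ (x.col 0)) fun k x y hxy hside =>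
    (hcol x y _).2 <| hφ k _ (by rw [map_sub, sub_eq_zero]; exact hxy) ((hcol x y _).1 hside)
  have hE : 0 < Real.log (Nat.card E) := Real.log_pos (mod_cast Finite.one_lt_card)
  refine (optCost_le s).trans_eq ?_
  change Real.logb (Nat.card F) (Nat.card W) / (1 : ℕ) = _
  rw [Real.logb, Module.natCard_eq_pow_finrank (K := E) (V := W),
    Module.natCard_eq_pow_finrank (K := E) (V := F), Nat.cast_pow, Nat.cast_pow, Real.log_pow,
    Real.log_pow, Nat.cast_one, div_one, mul_div_mul_right _ _ hE.ne']

end OptCost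

/-! ### Events of high probability -/

section Prob

open scoped BigOperators

variable {α β : Type}

open Classical in
theorem prob_eq_expect [Fintype α] (P : α → Prop) :
    prob α P = 𝔼 a, if P a then (1 : ℝ) else 0 := by
  rw [prob, Fintype.expect_eq_sum_div_card, Finset.sum_boole, Nat.card_eq_fintype_card,
    Nat.card_eq_fintype_card, Fintype.card_subtype]

theorem prob_nonneg (P : α → Prop) : 0 ≤ prob α P := by
  rw [prob]
  positivity

theorem prob_false : prob α (fun _ => False) = 0 := by simp [prob]

theorem prob_congr (e : α ≃ β) {P : α → Prop} {Q : β → Prop} (h : ∀ a, P a ↔ Q (e a)) :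
    prob α P = prob β Q := by
  rw [prob, prob, Nat.card_congr e, Nat.card_congr (e.subtypeEquiv h)]

theorem prob_mono [Finite α] {P Q : α → Prop} (h : ∀ a, P a → Q a) : prob α P ≤ prob α Q := by
  rw [prob, prob]
  gcongr
  exact Nat.card_mono (Set.toFinite {a | Q a}) h

theorem prob_add_prob_not [Finite α] [Nonempty α] (P : α → Prop) :
    prob α P + prob α (fun a => ¬ P a) = 1 := by
  classical
  have := Fintype.ofFinite α
  rw [prob_eq_expect, prob_eq_expect, ← Finset.expect_add_distrib,
    ← Fintype.expect_const (ι := α) (1 : ℝ)]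
  refine Finset.expect_congr rfl fun a _ => ?_
  by_cases h : P a <;> simp [h]

theorem prob_exists_le [Finite α] {ι : Type*} [Fintype ι] (P : ι → α → Prop) :
    prob α (fun a => ∃ i, P i a) ≤ ∑ i, prob α (P i) := by
  classical
  have := Fintype.ofFinite α
  simp only [prob_eq_expect]
  rw [← Finset.expect_sum_comm]
  refine Finset.expect_le_expect fun a _ => ?_
  split_ifs with h
  · obtain ⟨i, hi⟩ := h
    calc (1 : ℝ) = if P i a then 1 else 0 := (if_pos hi).symm
      _ ≤ ∑ i, if P i a then (1 : ℝ) else 0 :=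
        Finset.single_le_sum (f := fun i => if P i a then (1 : ℝ) else 0)
          (fun j _ => by positivity) (Finset.mem_univ i)
  · positivity

theorem prob_or_le [Finite α] (P Q : α → Prop) :
    prob α (fun a => P a ∨ Q a) ≤ prob α P + prob α Q := by
  have h := prob_exists_le fun b : Bool => cond b P Q
  rw [Fintype.sum_bool] at h
  exact (prob_mono fun _ ha => ha.elim (⟨true, ·⟩) (⟨false, ·⟩)).trans h

theorem prob_add_left {V : Type} [AddGroup V] (P : V → Prop) (v : V) :
    prob V (fun x => P (v + x)) = prob V P :=
  prob_congr (Equiv.addLeft v) fun _ => Iff.rfl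

/-- Conditioning: translating a uniform `x` by an independent `e w` does not change its law. -/
theorem prob_le_of_translate {V W : Type} [AddGroup V] [Finite V] [Finite W] [Nonempty W]
    (e : W → V) {P : V → Prop} {δ : ℝ} (h : ∀ x, prob W (fun w => P (x + e w)) ≤ δ) :
    prob V P ≤ δ := by
  classical
  have := Fintype.ofFinite V
  have := Fintype.ofFinite W
  calc prob V P = 𝔼 w : W, 𝔼 x, if P (x + e w) then (1 : ℝ) else 0 := by
        rw [prob_eq_expect, ← Fintype.expect_const (ι := W) (Finset.expect _ _)]
        exact Finset.expect_congr rfl fun w _ =>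
          (Fintype.expect_equiv (Equiv.addRight (e w)) _ _ fun _ => rfl).symm
    _ = 𝔼 x, prob W fun w => P (x + e w) := by
        rw [Finset.expect_comm]
        simp only [prob_eq_expect]
    _ ≤ 𝔼 _x : V, δ := Finset.expect_le_expect fun x _ => h x
    _ = δ := Fintype.expect_const δ

end Prob

section Whp

variable {α : ℕ → Type} [∀ n, Finite (α n)]

/-- The filter of the events in a sequence of finite probability spaces whose probability tends
to 1, so that convergence in probability is convergence along this filter. -/
def whp (α : ℕ → Type) [∀ n, Finite (α n)] : Filter (Σ n, α n) where
  sets := {s | Tendsto (fun n => prob (α n) fun a => Sigma.mk n a ∉ s) atTop (𝓝 0)}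
  univ_sets := by
    simp only [Set.mem_ofPred_eq, Set.mem_univ, not_true_eq_false, prob_false]
    exact tendsto_const_nhds
  sets_of_superset := fun hs hst => squeeze_zero (fun n => prob_nonneg _)
    (fun n => prob_mono fun _ => mt fun h => hst h) hs
  inter_sets := fun {s t} hs ht => by
    have hst := Tendsto.add hs ht
    rw [add_zero] at hst
    refine squeeze_zero (fun n => prob_nonneg _) (fun n => ?_) hst
    exact (prob_mono fun a ha => not_and_or.1 ha).trans (prob_or_le _ _)

theorem eventually_whp {P : (Σ n, α n) → Prop} :
    (∀ᶠ x in whp α, P x) ↔ Tendsto (fun n => prob (α n) fun a => ¬ P ⟨n, a⟩) atTop (𝓝 0) :=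
  Iff.rfl

theorem eventually_whp_of_le {P : (Σ n, α n) → Prop} {b : ℕ → ℝ} (hb : Tendsto b atTop (𝓝 0))
    (h : ∀ᶠ n in atTop, prob (α n) (fun a => ¬ P ⟨n, a⟩) ≤ b n) : ∀ᶠ x in whp α, P x :=
  squeeze_zero' (Eventually.of_forall fun _ => prob_nonneg _) h hb

variable [∀ n, Nonempty (α n)]

theorem eventually_whp_iff_tendsto_one {P : (Σ n, α n) → Prop} :
    (∀ᶠ x in whp α, P x) ↔ Tendsto (fun n => prob (α n) fun a => P ⟨n, a⟩) atTop (𝓝 1) := by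
  have hprob (n : ℕ) := prob_add_prob_not (α := α n) fun a => P ⟨n, a⟩
  rw [eventually_whp]
  constructor <;> intro h
  · exact (sub_zero (1 : ℝ) ▸ h.const_sub 1).congr fun n => by linarith [hprob n]
  · exact (sub_self (1 : ℝ) ▸ h.const_sub 1).congr fun n => by linarith [hprob n]

instance : (whp α).NeBot := by
  refine ⟨fun h => zero_ne_one (α := ℝ) ?_⟩
  have hfalse : ∀ᶠ _x in whp α, False := h ▸ eventually_bot
  rw [eventually_whp_iff_tendsto_one] at hfalse
  simp only [prob_false] at hfalse
  exact tendsto_nhds_unique tendsto_const_nhds hfalse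

end Whp

section GenericInstance

/-- The high probability events for uniformly random instances over `GaloisField p n`, `n → ∞`. -/
abbrev generic (p : ℕ) [Fact p.Prime] (K d m m' : ℕ) :
    Filter (Σ n, Inst (GaloisField p n) K d m m') :=
  whp fun n => Inst (GaloisField p n) K d m m'

variable {p : ℕ} [Fact p.Prime] {K d m m' : ℕ}

theorem isGenericCost_iff_tendsto {Δ : ℝ} :
    IsGenericCost p K d m m' Δ ↔ Tendsto (fun x => optCost x.2) (generic p K d m m') (𝓝 Δ) := by
  simp only [IsGenericCost, Metric.tendsto_nhds, Real.dist_eq, eventually_whp_iff_tendsto_one]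

theorem tendsto_div_card_galoisField (C : ℝ) :
    Tendsto (fun n => C / (Nat.card (GaloisField p n) : ℝ)) atTop (𝓝 0) := by
  have hp : (1 : ℝ) < p := mod_cast (Fact.out : p.Prime).one_lt
  refine ((tendsto_pow_atTop_atTop_of_one_lt hp).const_div_atTop C).congr' ?_
  filter_upwards [eventually_ne_atTop 0] with n hn
  rw [GaloisField.card p n hn, Nat.cast_pow]

end GenericInstance

/-! ### Random subspaces -/

section RandomSubspace

variable {F V : Type} [Field F] [Finite F] [AddCommGroup V] [Module F V] [FiniteDimensional F V]

theorem prob_mem_le {B : Submodule F V} (hB : B ≠ ⊤) : prob V (· ∈ B) ≤ 1 / Nat.card F := by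
  have hlt := Submodule.finrank_lt hB
  have hq : (1 : ℝ) ≤ Nat.card F := mod_cast Nat.card_pos (α := F)
  have hq0 : (0 : ℝ) < Nat.card F := one_pos.trans_le hq
  rw [prob, show Nat.card {x // x ∈ B} = _ from Module.natCard_eq_pow_finrank (K := F) (V := B),
    Module.natCard_eq_pow_finrank (K := F) (V := V), Nat.cast_pow, Nat.cast_pow,
    div_le_div_iff₀ (pow_pos hq0 _) hq0, one_mul, ← pow_succ]
  exact pow_le_pow_right₀ hq hlt

/-- The vectors `w` fail to be in general position to `A`: they do not enlarge its dimension as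
much as possible. -/
def Degenerate {r : ℕ} (A : Submodule F V) (w : Fin r → V) : Prop :=
  Module.finrank F ↥(A ⊔ Submodule.span F (Set.range w)) ≠
    min (Module.finrank F V) (Module.finrank F A + r)

omit [Finite F] in
theorem Degenerate.of_cons {r : ℕ} {A : Submodule F V} {v : V} {w : Fin r → V}
    (h : Degenerate A (Fin.cons v w : Fin (r + 1) → V)) :
    (A ≠ ⊤ ∧ v ∈ A) ∨ Degenerate (A ⊔ Submodule.span F {v}) w := by
  by_contra! hgood
  obtain ⟨hv, hw⟩ := hgood
  refine h ?_
  rw [Degenerate, not_not, sup_assoc, ← Submodule.span_union, Set.singleton_union,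
    ← Fin.range_cons] at hw
  rw [hw]
  by_cases hA : A = ⊤
  · subst hA
    rw [top_sup_eq, finrank_top, min_eq_left le_self_add, min_eq_left le_self_add]
  · rw [Submodule.finrank_sup_span_singleton (hv hA), add_assoc, add_comm 1 r]

theorem prob_degenerate_le (A : Submodule F V) (r : ℕ) :
    prob (Fin r → V) (Degenerate A) ≤ r / Nat.card F := by
  have : Finite V := Module.finite_of_finite F
  induction r generalizing A with
  | zero =>
    refine (prob_mono (Q := fun _ => False) fun w hw => hw ?_).trans (by simp [prob_false])
    rw [Set.range_eq_empty, Submodule.span_empty, sup_bot_eq, add_zero, min_eq_right A.finrank_le]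
  | succ r ih =>
    have hhead : prob (Fin (r + 1) → V) (fun w => A ≠ ⊤ ∧ w 0 ∈ A) ≤ 1 / Nat.card F := by
      by_cases hA : A = ⊤
      · simp only [hA, ne_eq, not_true_eq_false, false_and, prob_false]
        positivity
      · refine prob_le_of_translate (W := V) (fun v => Pi.single 0 v) fun x => ?_
        simp only [Pi.add_apply, Pi.single_eq_same]
        exact (prob_mono fun _ h => h.2).trans
          ((prob_add_left (· ∈ A) (x 0)).trans_le (prob_mem_le hA))
    have htail : prob (Fin (r + 1) → V)
        (fun w => Degenerate (A ⊔ Submodule.span F {w 0}) (Fin.tail w)) ≤ r / Nat.card F := by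
      refine prob_le_of_translate (W := Fin r → V) (fun w => Fin.cons 0 w) fun x => ?_
      have hcons (w : Fin r → V) : Fin.tail (x + Fin.cons 0 w : Fin (r + 1) → V) =
          Fin.tail x + w := rfl
      simp only [hcons, Pi.add_apply, Fin.cons_zero, add_zero]
      exact (prob_add_left (V := Fin r → V) (Degenerate _) (Fin.tail x)).trans_le (ih _)
    calc prob (Fin (r + 1) → V) (Degenerate A)
        ≤ _ := prob_mono fun w hw => ((Fin.cons_self_tail w).symm ▸ hw : Degenerate A _).of_cons
      _ ≤ _ := prob_or_le _ _
      _ ≤ 1 / Nat.card F + r / Nat.card F := add_le_add hhead htail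
      _ = (r + 1 : ℕ) / Nat.card F := by rw [← add_div, add_comm]; push_cast; rfl

theorem prob_finrank_sup_colSpan_ne {X : Type} [AddGroup X] [Finite X] {d r : ℕ}
    {M : X → Matrix (Fin d) (Fin r) F} (e : Matrix (Fin d) (Fin r) F → X)
    {A : X → Submodule F (Fin d → F)} (hM : ∀ x N, M (x + e N) = M x + N)
    (hA : ∀ x N, A (x + e N) = A x) :
    prob X (fun x => Module.finrank F ↥(A x ⊔ colSpan (M x)) ≠
      min d (Module.finrank F (A x) + r)) ≤ r / Nat.card F := by
  have hd : Module.finrank F (Fin d → F) = d := Module.finrank_fin_fun F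
  calc _ = prob X fun x => Degenerate (A x) (M x).col := by
        simp only [Degenerate, hd]
        rfl
    _ ≤ r / Nat.card F := by
      refine prob_le_of_translate (fun w : Fin r → _ => e (Matrix.of w).transpose) fun x => ?_
      simp only [hM, hA]
      exact (prob_add_left (Degenerate (A x)) (M x).col).trans_le (prob_degenerate_le (A x) r)

end RandomSubspace

section UserSpan

variable {K d m m' : ℕ}

/-- The instance with the given matrices at user `k` and zeros elsewhere. -/
def Inst.single {F : Type} [Field F] (k : Fin K) (N : Matrix (Fin d) (Fin m) F)
    (N' : Matrix (Fin d) (Fin m') F) : Inst F K d m m' :=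
  (Pi.single k N, Pi.single k N')

theorem Inst.demand_add_single {F : Type} [Field F] (I : Inst F K d m m') (k : Fin K)
    (N : Matrix (Fin d) (Fin m) F) (N' : Matrix (Fin d) (Fin m') F) :
    (I + Inst.single k N N').demand k = I.demand k + N := by
  simp [Inst.demand, Inst.single]

theorem Inst.side_add_single {F : Type} [Field F] (I : Inst F K d m m') (k : Fin K)
    (N : Matrix (Fin d) (Fin m) F) (N' : Matrix (Fin d) (Fin m') F) :
    (I + Inst.single k N N').side k = I.side k + N' := by
  simp [Inst.side, Inst.single]

theorem Inst.userSpan_add_single_of_ne {F : Type} [Field F] (I : Inst F K d m m') {j k : Fin K}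
    (h : j ≠ k) (N : Matrix (Fin d) (Fin m) F) (N' : Matrix (Fin d) (Fin m') F) :
    (I + Inst.single k N N').userSpan j = I.userSpan j := by
  simp [Inst.userSpan, Inst.demand, Inst.side, Inst.single, h]

variable {p : ℕ} [Fact p.Prime] (k : Fin K)
  {A : ∀ n, Inst (GaloisField p n) K d m m' →
    Submodule (GaloisField p n) (Fin d → GaloisField p n)}

theorem eventually_finrank_sup_colSpan_side
    (hA : ∀ n I N', A n (I + Inst.single k 0 N') = A n I) :
    ∀ᶠ x in generic p K d m m', Module.finrank (GaloisField p x.1)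
        ↥(A x.1 x.2 ⊔ colSpan (x.2.side k)) =
      min d (Module.finrank (GaloisField p x.1) (A x.1 x.2) + m') :=
  eventually_whp_of_le (tendsto_div_card_galoisField m') <| .of_forall fun n =>
    prob_finrank_sup_colSpan_ne (Inst.single k 0) (fun I N' => I.side_add_single k 0 N') (hA n)

theorem eventually_finrank_sup_userSpan
    (hA : ∀ n I N N', A n (I + Inst.single k N N') = A n I) :
    ∀ᶠ x in generic p K d m m', Module.finrank (GaloisField p x.1)
        ↥(A x.1 x.2 ⊔ x.2.userSpan k) =
      min d (Module.finrank (GaloisField p x.1) (A x.1 x.2) + (m + m')) := by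
  have hdemand : ∀ᶠ x in generic p K d m m', Module.finrank (GaloisField p x.1)
        ↥(A x.1 x.2 ⊔ colSpan (x.2.side k) ⊔ colSpan (x.2.demand k)) =
      min d (Module.finrank (GaloisField p x.1) ↥(A x.1 x.2 ⊔ colSpan (x.2.side k)) + m) :=
    eventually_whp_of_le (tendsto_div_card_galoisField m) <| .of_forall fun n =>
      prob_finrank_sup_colSpan_ne (fun N => Inst.single k N 0)
        (A := fun I => A n I ⊔ colSpan (I.side k))
        (fun I N => I.demand_add_single k N 0)
        (fun I N => by rw [hA, I.side_add_single, add_zero])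
  filter_upwards [eventually_finrank_sup_colSpan_side k fun n I N' => hA n I 0 N', hdemand]
    with x hside hdemand
  rw [Inst.userSpan, sup_comm (colSpan _), ← sup_assoc, hdemand, hside]
  omega

theorem eventually_finrank_userSpan : ∀ᶠ x in generic p K d m m', ∀ k,
    Module.finrank (GaloisField p x.1) (x.2.userSpan k) = min d (m + m') := by
  refine eventually_all.2 fun k => ?_
  filter_upwards [eventually_finrank_sup_userSpan k (A := fun _ _ => ⊥) fun _ _ _ _ => rfl]
    with x hx
  rwa [bot_sup_eq, finrank_bot, zero_add] at hx

theorem eventually_transversal_colSpan_side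
    (hA : ∀ n I N', A n (I + Inst.single k 0 N') = A n I) :
    ∀ᶠ x in generic p K d m m', Transversal (A x.1 x.2) (colSpan (x.2.side k)) := by
  filter_upwards [eventually_finrank_sup_colSpan_side k hA] with x hx
  refine transversal_of_finrank_sup (finrank_colSpan_le _) (hx.trans ?_)
  rw [Module.finrank_fin_fun, Fintype.card_fin]

theorem eventually_transversal_userSpan
    (hA : ∀ n I N N', A n (I + Inst.single k N N') = A n I) :
    ∀ᶠ x in generic p K d m m', Transversal (A x.1 x.2) (x.2.userSpan k) := by
  filter_upwards [eventually_finrank_sup_userSpan k hA, eventually_finrank_userSpan] with x hx hdim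
  refine transversal_of_finrank_sup ((hdim k).trans_le (min_le_right _ _)) (hx.trans ?_)
  rw [Module.finrank_fin_fun]

end UserSpan

/-! ### The generic converse -/

section Converse

variable {p : ℕ} [Fact p.Prime] {K d m m' : ℕ}

theorem eventually_transversal_chain : ∀ᶠ x in generic p K d m m',
    ∀ k : Fin K, Transversal (chain x.2.userSeq k) (x.2.userSpan k) := by
  refine eventually_all.2 fun k =>
    eventually_transversal_userSpan k (A := fun _ I => chain I.userSeq k) fun n I N N' => ?_
  refine chain_congr fun i hi => ?_
  rw [Inst.userSeq_of_lt _ (hi.trans k.2), Inst.userSeq_of_lt _ (hi.trans k.2)]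
  exact I.userSpan_add_single_of_ne (Fin.ne_of_lt hi) N N'

theorem eventually_mul_min_sub_le_mul_optCost {k c : ℕ} (hk : k ≤ K)
    (hc : k * min d (m + m') ≤ c * d) : ∀ᶠ x in generic p K d m m',
      (k * ((min d (m + m') : ℕ) - m') : ℝ) ≤ c * optCost x.2 := by
  filter_upwards [eventually_transversal_chain, eventually_finrank_userSpan] with x htrans hdim
  have hrank : ∀ i ∈ Finset.range k,
      Module.finrank (GaloisField p x.1) (x.2.userSeq i) = min d (m + m') := fun i hi => by
    rw [x.2.userSeq_of_lt ((Finset.mem_range.1 hi).trans_le hk), hdim]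
  have hsum := sum_finrank_userSeq_sub_le_mul_optCost (c := c) hk
    (fun i hi => by rw [x.2.userSeq_of_lt (hi.trans_le hk)]; exact htrans ⟨i, hi.trans_le hk⟩)
    (by rwa [Finset.sum_congr rfl hrank, Finset.sum_const, Finset.card_range, smul_eq_mul])
  rwa [Finset.sum_congr rfl fun i hi => by rw [hrank i hi], Finset.sum_const, Finset.card_range,
    nsmul_eq_mul] at hsum

theorem IsGenericCost.mul_min_sub_le {Δ : ℝ} (hΔ : IsGenericCost p K d m m' Δ) {k c : ℕ}
    (hk : k ≤ K) (hc : k * min d (m + m') ≤ c * d) :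
    (k * ((min d (m + m') : ℕ) - m') : ℝ) ≤ c * Δ :=
  ge_of_tendsto ((isGenericCost_iff_tendsto.1 hΔ).const_mul (c : ℝ))
    (eventually_mul_min_sub_le_mul_optCost hk hc)

end Converse

/-! ### Broadcasting a common vector of all users -/

section CommonVector

variable {F : Type} [Field F] {d : ℕ}

theorem vecMul_eq_zero_iff_colSpan_le {n : ℕ} {δ : Fin d → F} {M : Matrix (Fin d) (Fin n) F} :
    Matrix.vecMul δ M = 0 ↔ colSpan M ≤ LinearMap.ker (dotProductBilin F F δ) := by
  rw [colSpan, Submodule.span_le, Set.range_subset_iff, funext_iff]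
  rfl

theorem optCost_le_finrank [Finite F] {K m m' : ℕ} {I : Inst F K d m m'}
    (W : Submodule F (Fin d → F)) (hW : ∀ k, colSpan (I.demand k) ≤ W ⊔ colSpan (I.side k)) :
    optCost I ≤ Module.finrank F W := by
  refine (optCost_le_of_linearMap ((dotProductBilin F F).domRestrict₂ W)
    fun k δ hδ hside => ?_).trans_eq ?_
  · rw [vecMul_eq_zero_iff_colSpan_le] at hside ⊢
    exact (hW k).trans (sup_le (fun w hw => LinearMap.congr_fun hδ (⟨w, hw⟩ : W)) hside)
  · rw [Module.finrank_self, Nat.cast_one, div_one]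
    exact congrArg Nat.cast Subspace.dual_finrank_eq

theorem colSpan_demand_le_of_mem_userSpan {K m' : ℕ} {I : Inst F K d 1 m'} {k : Fin K}
    {w : Fin d → F} (hw : w ∈ I.userSpan k) (hside : w ∉ colSpan (I.side k)) :
    colSpan (I.demand k) ≤ Submodule.span F {w} ⊔ colSpan (I.side k) := by
  have hdemand : colSpan (I.demand k) = Submodule.span F {(I.demand k).col 0} := by
    rw [colSpan, Set.range_unique]
    rfl
  rw [Inst.userSpan, hdemand, colSpan, ← Submodule.span_union, Set.singleton_union] at hw
  rw [hdemand, colSpan, ← Submodule.span_union, Set.singleton_union,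
    Submodule.span_singleton_le_iff_mem]
  exact mem_span_insert_exchange hw hside

section FamilyOfSubspaces

variable {V ι : Type*} [AddCommGroup V] [Module F V] [FiniteDimensional F V]
  {U : ι → Submodule F V} {r : ℕ}

theorem finrank_finset_inf_add (hU : ∀ i, Module.finrank F (U i) + r = Module.finrank F V)
    (htrans : ∀ t : Finset ι, ∀ i ∉ t, Transversal (t.inf U) (U i)) {s : Finset ι}
    (hs : s.card * r ≤ Module.finrank F V) :
    Module.finrank F ↥(s.inf U) + s.card * r = Module.finrank F V := by
  classical
  induction s using Finset.induction_on with
  | empty => rw [Finset.inf_empty, finrank_top, Finset.card_empty, zero_mul, add_zero]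
  | insert i s hi ih =>
    rw [Finset.card_insert_of_notMem hi, add_one_mul] at hs ⊢
    have hUi := hU i
    have hs' := ih (by omega)
    have hadd := Submodule.finrank_sup_add_finrank_inf_eq (s.inf U) (U i)
    rw [((htrans s i hi).codisjoint (by omega)).eq_top, finrank_top, inf_comm] at hadd
    rw [Finset.inf_insert]
    omega

theorem exists_forall_mem_notMem [Fintype ι] [DecidableEq ι] {S : ι → Submodule F V}
    (hV : Module.finrank F V = Fintype.card ι * r + 1)
    (hU : ∀ i, Module.finrank F (U i) + r = Module.finrank F V)
    (hS : ∀ i, Module.finrank F (S i) < Module.finrank F (U i))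
    (htrans : ∀ t : Finset ι, ∀ i ∉ t, Transversal (t.inf U) (U i))
    (htransS : ∀ i, Transversal ((Finset.univ.erase i).inf U) (S i)) :
    ∃ w, ∀ i, w ∈ U i ∧ w ∉ S i := by
  have huniv := finrank_finset_inf_add hU htrans (s := Finset.univ) (by
    rw [Finset.card_univ]; omega)
  obtain ⟨w, hw, hw0⟩ := Submodule.exists_mem_ne_zero_of_ne_bot (p := Finset.univ.inf U)
    fun h => by rw [h, finrank_bot, Finset.card_univ] at huniv; omega
  have hwinf (s : Finset ι) : w ∈ s.inf U :=
    (Finset.inf_mono (f := U) s.subset_univ : _ ≤ _) hw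
  refine ⟨w, fun i => ⟨by simpa using hwinf {i}, fun hwi => hw0 ?_⟩⟩
  have hcard := Finset.card_erase_add_one (Finset.mem_univ i)
  rw [Finset.card_univ] at hcard
  have hmul : Fintype.card ι * r = (Finset.univ.erase i).card * r + r := by
    rw [← hcard, add_one_mul]
  have herase := finrank_finset_inf_add hU htrans (s := Finset.univ.erase i) (by omega)
  have hUi := hU i
  have hSi := hS i
  exact (Submodule.disjoint_def.1 ((htransS i).disjoint (by omega))) w (hwinf _) hwi

end FamilyOfSubspaces

variable (p : ℕ) [Fact p.Prime] (k r : ℕ)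

theorem eventually_exists_common_vector :
    ∀ᶠ x in generic p (k + 1) ((k + 1) * r + 1) 1 (k * r),
      ∃ w, ∀ j, w ∈ x.2.userSpan j ∧ w ∉ colSpan (x.2.side j) := by
  have huser : ∀ᶠ x in generic p (k + 1) ((k + 1) * r + 1) 1 (k * r),
      ∀ t : {t : Finset (Fin (k + 1)) × Fin (k + 1) // t.2 ∉ t.1},
        Transversal (t.1.1.inf x.2.userSpan) (x.2.userSpan t.1.2) :=
    eventually_all.2 fun t => eventually_transversal_userSpan t.1.2
      (A := fun _ I => t.1.1.inf I.userSpan) fun n I N N' => Finset.inf_congr rfl fun j hj =>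
        I.userSpan_add_single_of_ne (ne_of_mem_of_not_mem hj t.2) N N'
  have hside : ∀ᶠ x in generic p (k + 1) ((k + 1) * r + 1) 1 (k * r), ∀ j,
      Transversal ((Finset.univ.erase j).inf x.2.userSpan) (colSpan (x.2.side j)) :=
    eventually_all.2 fun j => eventually_transversal_colSpan_side j
      (A := fun _ I => (Finset.univ.erase j).inf I.userSpan) fun n I N' =>
        Finset.inf_congr rfl fun i hi =>
          I.userSpan_add_single_of_ne (Finset.ne_of_mem_erase hi) 0 N'
  filter_upwards [huser, hside, eventually_finrank_userSpan] with x huser hside hdim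
  have hkr : (k + 1) * r = k * r + r := add_one_mul k r
  refine exists_forall_mem_notMem (r := r) ?_ (fun j => ?_) (fun j => ?_)
    (fun t j hj => huser ⟨(t, j), hj⟩) hside
  · rw [Module.finrank_fin_fun, Fintype.card_fin]
  · rw [hdim, Module.finrank_fin_fun]
    omega
  · have hle := finrank_colSpan_le (x.2.side j)
    rw [Fintype.card_fin] at hle
    rw [hdim]
    omega

theorem isGenericCost_one : IsGenericCost p (k + 1) ((k + 1) * r + 1) 1 (k * r) 1 := by
  have hkr : (k + 1) * r = k * r + r := add_one_mul k r
  have hlower := eventually_mul_min_sub_le_mul_optCost (p := p) (K := k + 1)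
    (d := (k + 1) * r + 1) (m := 1) (m' := k * r) (k := 1) (c := 1) (by omega) (by omega)
  refine isGenericCost_iff_tendsto.2 (tendsto_const_nhds.congr' ?_)
  filter_upwards [hlower, eventually_exists_common_vector p k r] with x hlower ⟨w, hw⟩
  refine le_antisymm ?_ ?_
  · rw [min_eq_right (by omega)] at hlower
    push_cast at hlower
    linarith
  · refine (optCost_le_finrank _ fun j =>
      colSpan_demand_le_of_mem_userSpan (hw j).1 (hw j).2).trans ?_
    exact_mod_cast (finrank_span_le_card {w}).trans_eq (by simp)

end CommonVector

/-! ### Interference alignment -/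

section Alignment

variable {F E : Type} [Field F] [Field E] [Algebra E F] {K d m m' : ℕ}

/-- The server sends the products of the data with `P'`, which serve all users at once, and those
of the demands with a complement of `P`, which serve one user each. -/
theorem optCost_le_of_alignment [Finite F] {I : Inst F K d m m'} (P P' : Submodule E F)
    (hP : ∀ k l, ∀ b ∈ P, b • (I.demand k).col l ∈
      Submodule.pi Set.univ (fun _ => P') ⊔ (colSpan (I.side k)).restrictScalars E) :
    optCost I ≤ (d * Module.finrank E P' + K * m * (Module.finrank E F - Module.finrank E P)) /
      Module.finrank E F := by
  obtain ⟨C, hC⟩ := P.exists_isCompl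
  obtain ⟨τ, hτ⟩ := exists_ne (0 : Module.Dual E F)
  let B : F →ₗ[E] F →ₗ[E] E := (LinearMap.mul E F).compr₂ τ
  let dot (k : Fin K) (l : Fin m) : (Fin d → F) →ₗ[E] F :=
    ((dotProductBilin F F).flip ((I.demand k).col l)).restrictScalars E
  let φ := (LinearMap.pi fun j => B.domRestrict₂ P' ∘ₗ LinearMap.proj j).prod
    (LinearMap.pi fun k => LinearMap.pi fun l => B.domRestrict₂ C ∘ₗ dot k l)
  refine (optCost_le_of_linearMap φ fun k δ hδ hside => ?_).trans_eq ?_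
  · have hdata (j : Fin d) {c : F} (hc : c ∈ P') : τ (δ j * c) = 0 :=
      LinearMap.congr_fun (congrFun (Prod.ext_iff.1 hδ).1 j) (⟨c, hc⟩ : P')
    funext l
    set y := δ ⬝ᵥ (I.demand k).col l with hy
    have hzero : (⊤ : Submodule E F) ≤ LinearMap.ker (B y) := by
      rw [← hC.sup_eq_top]
      refine sup_le (fun b hb => ?_) fun c hc => LinearMap.congr_fun
        (congrFun (congrFun (Prod.ext_iff.1 hδ).2 k) l) (⟨c, hc⟩ : C)
      obtain ⟨c, hc, s, hs, hcs⟩ := Submodule.mem_sup.1 (hP k l b hb)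
      have hδs : δ ⬝ᵥ s = 0 := vecMul_eq_zero_iff_colSpan_le.1 hside hs
      have hyb : y * b = δ ⬝ᵥ c := by
        rw [hy, mul_comm, ← smul_eq_mul, ← dotProduct_smul, ← hcs, dotProduct_add, hδs, add_zero]
      rw [LinearMap.mem_ker]
      change τ (y * b) = 0
      rw [hyb, dotProduct, map_sum]
      exact Finset.sum_eq_zero fun j _ => hdata j (hc j trivial)
    by_contra (hne : y ≠ 0)
    refine hτ (LinearMap.ext fun a => ?_)
    have ha : τ (y * (y⁻¹ * a)) = 0 := hzero (Submodule.mem_top (x := y⁻¹ * a))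
    rwa [mul_inv_cancel_left₀ hne] at ha
  · have hdim := Submodule.finrank_add_eq_of_isCompl hC
    simp only [Module.finrank_prod, Module.finrank_pi_fintype, Subspace.dual_finrank_eq,
      Finset.sum_const, Finset.card_univ, Fintype.card_fin, smul_eq_mul, ← hdim]
    push_cast
    ring

variable {κ σ : Type} [Fintype σ]

/-- The products of the `b i` with the monomials of degree less than `N` in each of the `z t`, which
span the alignment spaces: multiplication by a `z t` maps one such span to the next. -/
def monomialFamily (b : κ → F) (N : ℕ) (z : σ → F) (i : κ × (σ → Fin N)) : F :=
  b i.1 * ∏ t, z t ^ (i.2 t : ℕ)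

theorem exists_monomialFamily_succ_eq_mul (b : κ → F) {N : ℕ} (z : σ → F) (i : κ)
    (e : σ → Fin N) (t : σ) :
    ∃ e', monomialFamily b (N + 1) z (i, e') = monomialFamily b N z (i, e) * z t := by
  classical
  refine ⟨Function.update (fun s => (e s).castSucc) t (e t).succ, ?_⟩
  have herase (s : σ) (hs : s ∈ Finset.univ.erase t) :
      z s ^ (Function.update (fun s => (e s).castSucc) t (e t).succ s : ℕ) = z s ^ (e s : ℕ) := by
    rw [Function.update_of_ne (Finset.ne_of_mem_erase hs), Fin.val_castSucc]
  rw [monomialFamily, monomialFamily, mul_assoc, ← Finset.mul_prod_erase _ _ (Finset.mem_univ t),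
    ← Finset.mul_prod_erase _ _ (Finset.mem_univ t), Finset.prod_congr rfl herase]
  simp only [Function.update_self, Fin.val_succ, pow_succ]
  ring

/-- The coordinates of the vectors `θ ^ i • v k + v' k i`, where `v k` is the demand of user `k`,
`v' k 0 = 0` and the other `v' k i` are the columns of its side information. Up to side information
these vectors are multiples of the demand, and for a random instance they are uniform. -/
def alignVars (θ : F) : Inst F K d 1 m' ≃ (Fin K × Fin (m' + 1) × Fin d → F) where
  toFun I t := θ ^ (t.2.1 : ℕ) * I.demand t.1 t.2.2 0 +
    (Fin.cons 0 (I.side t.1 t.2.2) : Fin (m' + 1) → F) t.2.1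
  invFun z := (fun k => Matrix.of fun j _ => z (k, 0, j),
    fun k => Matrix.of fun j l => z (k, l.succ, j) - θ ^ (l.succ : ℕ) * z (k, 0, j))
  left_inv I := by
    refine Prod.ext (funext fun k => ?_) (funext fun k => ?_)
    · ext j i
      simp [Inst.demand, Subsingleton.elim i 0]
    · ext j i
      simp [Inst.demand, Inst.side]
  right_inv z := by
    funext ⟨k, i, j⟩
    induction i using Fin.cases <;> simp [Inst.demand, Inst.side]

theorem alignVars_sub_smul_demand_mem (θ : F) (I : Inst F K d 1 m') (k : Fin K)
    (i : Fin (m' + 1)) :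
    (fun j => alignVars θ I (k, i, j)) - θ ^ (i : ℕ) • (I.demand k).col 0 ∈
      colSpan (I.side k) := by
  have hsub : (fun j => alignVars θ I (k, i, j)) - θ ^ (i : ℕ) • (I.demand k).col 0 =
      fun j => (Fin.cons 0 (I.side k j) : Fin (m' + 1) → F) i :=
    funext fun j => add_sub_cancel_left _ _
  rw [hsub]
  induction i using Fin.cases with
  | zero => exact zero_mem _
  | succ l => exact Submodule.subset_span ⟨l, rfl⟩

theorem monomialFamily_smul_demand_mem (θ : F) (I : Inst F K d 1 m') (b : κ → F) (N : ℕ)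
    (k : Fin K) (i : (κ × Fin (m' + 1)) × _) :
    monomialFamily (fun i => b i.1 * θ ^ (i.2 : ℕ)) N (alignVars θ I) i • (I.demand k).col 0 ∈
      Submodule.pi Set.univ
        (fun _ => Submodule.span E (Set.range (monomialFamily b (N + 1) (alignVars θ I)))) ⊔
      (colSpan (I.side k)).restrictScalars E := by
  obtain ⟨⟨i, l⟩, e⟩ := i
  set z := alignVars θ I
  set c := monomialFamily b N z (i, e) with hc
  have hsplit : monomialFamily (fun i => b i.1 * θ ^ (i.2 : ℕ)) N z ((i, l), e) •
      (I.demand k).col 0 = c • (fun j => z (k, l, j)) -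
        c • ((fun j => z (k, l, j)) - θ ^ (l : ℕ) • (I.demand k).col 0) := by
    rw [smul_sub, sub_sub_cancel, smul_smul, hc, monomialFamily, monomialFamily, mul_right_comm]
  rw [hsplit, sub_eq_add_neg]
  refine Submodule.add_mem_sup (fun j _ => ?_) (neg_mem ?_)
  · obtain ⟨e', he'⟩ := exists_monomialFamily_succ_eq_mul b z i e (k, l, j)
    exact Submodule.subset_span ⟨(i, e'), he'⟩
  · exact (colSpan (I.side k)).smul_mem c (alignVars_sub_smul_demand_mem θ I k l)

theorem optCost_le_of_linearIndependent_monomialFamily [Finite F] [Fintype κ]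
    {I : Inst F K d 1 m'} {θ : F} {N : ℕ} {b : κ → F}
    (hI : LinearIndependent E (monomialFamily (fun i : κ × Fin (m' + 1) => b i.1 * θ ^ (i.2 : ℕ)) N
      (alignVars θ I))) :
    optCost I ≤ (d * (Fintype.card κ * (N + 1) ^ (K * ((m' + 1) * d))) + K * (Module.finrank E F -
      Fintype.card κ * (m' + 1) * N ^ (K * ((m' + 1) * d)))) / Module.finrank E F := by
  set z := alignVars θ I
  set P := Submodule.span E
    (Set.range (monomialFamily (fun i : κ × Fin (m' + 1) => b i.1 * θ ^ (i.2 : ℕ)) N z))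
  set P' := Submodule.span E (Set.range (monomialFamily b (N + 1) z))
  have hP : Module.finrank E P = _ := finrank_span_eq_card hI
  have hP' : Module.finrank E P' ≤ _ := finrank_range_le_card (monomialFamily b (N + 1) z)
  simp only [Fintype.card_prod, Fintype.card_fun, Fintype.card_fin] at hP hP'
  refine (optCost_le_of_alignment P P' fun k l a ha => ?_).trans ?_
  · obtain rfl : l = 0 := Subsingleton.elim l 0
    let f := (LinearMap.toSpanSingleton F (Fin d → F) ((I.demand k).col 0)).restrictScalars E
    let Q := Submodule.pi Set.univ (fun _ => P') ⊔ (colSpan (I.side k)).restrictScalars E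
    have hPQ : P ≤ Q.comap f := Submodule.span_le.2 <| Set.range_subset_iff.2 <|
      monomialFamily_smul_demand_mem θ I b N k
    exact hPQ ha
  · rw [hP]
    push_cast
    rw [mul_one]
    gcongr
    exact_mod_cast hP'

end Alignment

section RandomMonomials

variable {F σ : Type} [Field F]

theorem prob_eval_eq_zero_le [Finite F] [Finite σ] {P : MvPolynomial σ F} (hP : P ≠ 0) :
    prob (σ → F) (fun z => MvPolynomial.eval z P = 0) ≤ P.totalDegree / Nat.card F := by
  classical
  have := Fintype.ofFinite F
  have := Fintype.ofFinite σ
  let e := Fintype.equivFin σ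
  have hPe : MvPolynomial.rename e P ≠ 0 := by
    rwa [Ne, MvPolynomial.rename_eq_zero_iff_of_injective _ e.injective]
  calc prob (σ → F) (fun z => MvPolynomial.eval z P = 0)
      = prob (Fin (Fintype.card σ) → F)
          fun z => MvPolynomial.eval z (MvPolynomial.rename e P) = 0 :=
        prob_congr (e.arrowCongr (Equiv.refl F)) fun z => by
          rw [MvPolynomial.eval_rename]
          simp [Function.comp_def]
    _ ≤ (MvPolynomial.rename e P).totalDegree / Nat.card F := by
        have hzippel := (NNRat.cast_le (K := ℝ)).2 <|
          MvPolynomial.schwartz_zippel_totalDegree hPe Finset.univ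
        rw [Fintype.piFinset_univ, Finset.card_univ] at hzippel
        rw [prob, Nat.card_eq_fintype_card, Fintype.card_subtype, Nat.card_eq_fintype_card,
          Nat.card_eq_fintype_card, Fintype.card_fun, Fintype.card_fin]
        push_cast at hzippel ⊢
        exact hzippel
    _ ≤ P.totalDegree / Nat.card F := by
        gcongr
        exact MvPolynomial.totalDegree_rename_le _ _

variable {E κ : Type} [Field E] [Algebra E F] [Fintype κ] [Fintype σ] {b : κ → F} {N : ℕ}

theorem exists_mvPolynomial_eval_eq_sum_monomialFamily [DecidableEq σ]
    (hb : LinearIndependent E b) {a : κ × (σ → Fin N) → E} (ha : a ≠ 0) :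
    ∃ P : MvPolynomial σ F, P ≠ 0 ∧ P.totalDegree ≤ Fintype.card σ * N ∧
      ∀ z, MvPolynomial.eval z P = ∑ i, a i • monomialFamily b N z i := by
  classical
  let exponent (e : σ → Fin N) : σ →₀ ℕ := Finsupp.equivFunOnFinite.symm fun t => e t
  have hexponent : Function.Injective exponent := fun e e' h =>
    funext fun t => Fin.ext (DFunLike.congr_fun h t)
  let P : MvPolynomial σ F :=
    ∑ e, MvPolynomial.monomial (exponent e) (∑ i, a (i, e) • b i)
  refine ⟨P, fun hP => ha (funext fun ⟨i, e⟩ => ?_), ?_, fun z => ?_⟩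
  · have hcoeff : P.coeff (exponent e) = ∑ i, a (i, e) • b i := by
      simp [P, MvPolynomial.coeff_sum, MvPolynomial.coeff_monomial, hexponent.eq_iff]
    rw [hP, MvPolynomial.coeff_zero] at hcoeff
    exact Fintype.linearIndependent_iff.1 hb (fun i => a (i, e)) hcoeff.symm i
  · refine MvPolynomial.totalDegree_finsetSum_le fun e _ =>
      (MvPolynomial.totalDegree_monomial_le _ _).trans ?_
    rw [Finsupp.sum_fintype _ _ fun _ => rfl, ← Finset.card_univ, ← smul_eq_mul]
    exact Finset.sum_le_card_nsmul _ _ _ fun t _ => (e t).isLt.le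
  · rw [map_sum, Fintype.sum_prod_type_right]
    refine Finset.sum_congr rfl fun e _ => ?_
    rw [MvPolynomial.eval_monomial, Finset.sum_mul, Finsupp.prod_fintype _ _ fun _ => pow_zero _]
    simp only [monomialFamily, exponent, Finsupp.equivFunOnFinite_symm_apply_apply, smul_mul_assoc]

theorem prob_not_linearIndependent_monomialFamily_le [Finite F] (hb : LinearIndependent E b) :
    prob (σ → F) (fun z => ¬ LinearIndependent E (monomialFamily b N z)) ≤
      Nat.card E ^ (Fintype.card κ * N ^ Fintype.card σ) *
        ((Fintype.card σ * N : ℕ) / Nat.card F : ℝ) := by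
  classical
  have : Finite E := Finite.of_injective _ (algebraMap E F).injective
  have := Fintype.ofFinite E
  let A := {a : κ × (σ → Fin N) → E // a ≠ 0}
  have hA : Fintype.card A ≤ Nat.card E ^ (Fintype.card κ * N ^ Fintype.card σ) :=
    (Fintype.card_subtype_le _).trans_eq (by
      rw [Fintype.card_fun, Nat.card_eq_fintype_card, Fintype.card_prod, Fintype.card_fun,
        Fintype.card_fin])
  calc prob (σ → F) (fun z => ¬ LinearIndependent E (monomialFamily b N z))
      ≤ prob (σ → F) (fun z => ∃ a : A, ∑ i, a.1 i • monomialFamily b N z i = 0) := by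
        refine prob_mono fun z hz => ?_
        obtain ⟨a, hsum, i, hi⟩ := Fintype.not_linearIndependent_iff.1 hz
        exact ⟨⟨a, fun ha => hi (congrFun ha i)⟩, hsum⟩
    _ ≤ ∑ a : A, prob (σ → F) (fun z => ∑ i, a.1 i • monomialFamily b N z i = 0) :=
        prob_exists_le _
    _ ≤ ∑ _a : A, ((Fintype.card σ * N : ℕ) / Nat.card F : ℝ) := Finset.sum_le_sum fun a _ => by
        obtain ⟨P, hP, hdegree, heval⟩ := exists_mvPolynomial_eval_eq_sum_monomialFamily hb a.2
        simp only [← heval]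
        refine (prob_eval_eq_zero_le hP).trans ?_
        gcongr
    _ ≤ _ := by
        rw [Finset.sum_const, nsmul_eq_mul, Finset.card_univ]
        gcongr
        exact_mod_cast hA

end RandomMonomials

section ManyUsers

section RandomInstance

variable {F E : Type} [Field F] [Finite F] [Field E] [Algebra E F] {K d m' : ℕ}

theorem exists_linearIndependent_mul_pow {S u : ℕ} (hS : S * u ≤ Module.finrank E F) :
    ∃ (b : Fin S → F) (θ : F),
      LinearIndependent E fun i : Fin S × Fin u => b i.1 * θ ^ (i.2 : ℕ) := by
  have : Finite E := Finite.of_injective _ (algebraMap E F).injective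
  let pb := Field.powerBasisOfFiniteOfSeparable E F
  rw [pb.finrank] at hS
  refine ⟨fun s => pb.gen ^ (u * s : ℕ), pb.gen, ?_⟩
  have hpow : LinearIndependent E fun i : Fin pb.dim => pb.gen ^ (i : ℕ) :=
    pb.coe_basis ▸ pb.basis.linearIndependent
  have hmul (i : Fin S × Fin u) : pb.gen ^ (u * i.1 : ℕ) * pb.gen ^ (i.2 : ℕ) =
      pb.gen ^ (Fin.castLE hS (finProdFinEquiv i) : ℕ) := by
    rw [← pow_add, add_comm]
    rfl
  simp only [hmul]
  exact hpow.comp _ ((Fin.castLE_injective hS).comp finProdFinEquiv.injective)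

theorem prob_not_optCost_le {S N r : ℕ} (hN : 0 < N)
    (hr : S * (m' + 1) * N ^ (K * ((m' + 1) * d)) + r = Module.finrank E F) :
    prob (Inst F K d 1 m') (fun I => ¬ optCost I ≤
      (d * (S * (N + 1) ^ (K * ((m' + 1) * d))) + K * r) / Module.finrank E F) ≤
      (K * ((m' + 1) * d) * N : ℕ) / (Nat.card E : ℝ) ^ r := by
  have : Finite E := Finite.of_injective _ (algebraMap E F).injective
  have hS : S * (m' + 1) ≤ Module.finrank E F :=
    (Nat.le_mul_of_pos_right _ (Nat.pow_pos hN)).trans (Nat.le.intro hr)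
  obtain ⟨b, θ, hb⟩ := exists_linearIndependent_mul_pow hS
  have hE : (Nat.card E : ℝ) ≠ 0 := Nat.cast_ne_zero.2 Nat.card_pos.ne'
  calc prob (Inst F K d 1 m') _
      ≤ prob (Inst F K d 1 m') fun I => ¬ LinearIndependent E
          (monomialFamily (fun i : Fin S × Fin (m' + 1) => b i.1 * θ ^ (i.2 : ℕ)) N
            (alignVars θ I)) := prob_mono fun I => mt fun hI => by
        refine (optCost_le_of_linearIndependent_monomialFamily hI).trans_eq ?_
        rw [Fintype.card_fin, ← hr]
        push_cast
        ring
    _ = prob (Fin K × Fin (m' + 1) × Fin d → F) fun z => ¬ LinearIndependent E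
          (monomialFamily (fun i : Fin S × Fin (m' + 1) => b i.1 * θ ^ (i.2 : ℕ)) N z) :=
        prob_congr (alignVars θ) fun _ => Iff.rfl
    _ ≤ _ := prob_not_linearIndependent_monomialFamily_le hb
    _ = _ := by
        rw [Module.natCard_eq_pow_finrank (K := E) (V := F), ← hr, pow_add]
        simp only [Fintype.card_prod, Fintype.card_fin]
        push_cast
        field_simp

end RandomInstance

variable (p : ℕ) [Fact p.Prime] {K d m' : ℕ}

theorem exists_mul_add_eq_sqrt_le {M : ℕ} (hM : 0 < M) (n : ℕ) :
    ∃ S r, S * M + r = n ∧ n.sqrt ≤ r ∧ r ≤ n.sqrt + M := by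
  have hdiv := Nat.div_add_mod' (n - n.sqrt) M
  have hmod := Nat.mod_lt (n - n.sqrt) hM
  have hsqrt := Nat.sqrt_le_self n
  exact ⟨(n - n.sqrt) / M, (n - n.sqrt) % M + n.sqrt, by omega, by omega, by omega⟩

theorem tendsto_natSqrt_atTop : Tendsto Nat.sqrt atTop atTop :=
  Monotone.tendsto_atTop_atTop (fun _ _ => Nat.sqrt_le_sqrt) fun n => ⟨n * n, (Nat.sqrt_eq n).ge⟩

theorem tendsto_mul_natSqrt_add_div (a b : ℝ) :
    Tendsto (fun n : ℕ => a * (n.sqrt + b) / n) atTop (𝓝 0) := by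
  have hsqrt : Tendsto (fun n : ℕ => (n.sqrt : ℝ) / n) atTop (𝓝 0) := by
    refine squeeze_zero (fun n => by positivity) (fun n => ?_)
      ((tendsto_const_div_atTop_nhds_zero_nat (1 : ℝ)).comp tendsto_natSqrt_atTop)
    rcases n.sqrt.eq_zero_or_pos with h | h
    · simp [h]
    · have hle : (n.sqrt * n.sqrt : ℝ) ≤ n := mod_cast n.sqrt_le
      rw [Function.comp_apply, div_le_div_iff₀ (mod_cast Nat.sqrt_pos.1 h) (by positivity), one_mul]
      exact hle
  have hlim := (hsqrt.const_mul a).add (tendsto_const_div_atTop_nhds_zero_nat (a * b))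
  rw [mul_zero, add_zero] at hlim
  exact hlim.congr fun n => by ring

theorem eventually_optCost_le_mul_pow_add {N : ℕ} (hN : 0 < N) {ε : ℝ} (hε : 0 < ε) :
    ∀ᶠ x in generic p K d 1 m',
      optCost x.2 ≤ d / (m' + 1) * ((N + 1) / N) ^ (K * ((m' + 1) * d)) + ε := by
  have hp : (1 : ℝ) < p := mod_cast (Fact.out : p.Prime).one_lt
  set T := K * ((m' + 1) * d) with hT
  set M := (m' + 1) * N ^ T with hM
  have hfail : Tendsto (fun n : ℕ => (T * N : ℕ) / (p : ℝ) ^ n.sqrt) atTop (𝓝 0) :=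
    ((tendsto_pow_atTop_atTop_of_one_lt hp).comp tendsto_natSqrt_atTop).const_div_atTop _
  refine eventually_whp_of_le hfail ?_
  filter_upwards [eventually_ne_atTop 0,
    (tendsto_mul_natSqrt_add_div K M).eventually_le_const hε] with n hn hrest
  obtain ⟨S, r, hSr, hle, hge⟩ := exists_mul_add_eq_sqrt_le (M := M) (by positivity) n
  have hrank := GaloisField.finrank p hn
  have hprob := prob_not_optCost_le (F := GaloisField p n) (E := ZMod p) (K := K) (d := d)
    (m' := m') (S := S) (r := r) hN (by rw [hrank, ← hSr, hM, mul_assoc])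
  rw [hrank, Nat.card_zmod, ← hT] at hprob
  refine (prob_mono fun I => mt fun hI => hI.trans ?_).trans (hprob.trans (by gcongr; exact hp.le))
  have hS : (S * ((m' + 1) * N ^ T) : ℝ) ≤ n := mod_cast Nat.le.intro hSr
  rw [add_div]
  refine add_le_add ?_ (le_trans ?_ hrest)
  · rw [div_le_iff₀ (by positivity)]
    calc (d * (S * (N + 1) ^ T) : ℝ)
        = d / (m' + 1) * ((N + 1) / N) ^ T * (S * ((m' + 1) * N ^ T)) := by
          rw [div_pow]
          field_simp
      _ ≤ d / (m' + 1) * ((N + 1) / N) ^ T * n := by gcongr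
  · gcongr
    exact_mod_cast hge

theorem isGenericCost_of_le (h : m' + 1 ≤ d) (hK : d ≤ K) :
    IsGenericCost p K d 1 m' (d / (m' + 1)) := by
  refine isGenericCost_iff_tendsto.2 (tendsto_order.2 ⟨fun c hc => ?_, fun c hc => ?_⟩)
  · filter_upwards [eventually_mul_min_sub_le_mul_optCost (p := p) (K := K) (d := d) (m := 1)
      (m' := m') (k := d) (c := m' + 1) hK (by rw [min_eq_right (by omega)]; nlinarith)] with x hx
    rw [min_eq_right (by omega)] at hx
    push_cast at hx
    rw [add_sub_cancel_right, mul_one] at hx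
    exact hc.trans_le ((div_le_iff₀' (by positivity)).2 hx)
  · have hlim : Tendsto (fun N : ℕ => (d : ℝ) / (m' + 1) * ((N + 1) / N) ^ (K * ((m' + 1) * d)))
        atTop (𝓝 (d / (m' + 1))) := by
      have hratio := (tendsto_natCast_div_add_atTop (1 : ℝ)).inv₀ one_ne_zero
      simp only [inv_div, inv_one] at hratio
      simpa using (hratio.pow _).const_mul (d / (m' + 1) : ℝ)
    obtain ⟨N, hlt, hN⟩ :=
      ((hlim.eventually_lt_const hc).and (eventually_gt_atTop 0)).exists
    filter_upwards [eventually_optCost_le_mul_pow_add p hN (half_pos (sub_pos.2 hlt))] with x hx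
    linarith

end ManyUsers

/-! ### Gains over the baseline schemes -/

section Baseline

variable {K d m m' : ℕ}

/-- The cost of the better baseline scheme, so that `baselineRate` is its reciprocal. -/
def baselineCost (K d m m' : ℕ) : ℕ := min (d - m') (K * m)

/-- The rank of a user's demand modulo its side information, in a generic instance. -/
def demandRank (d m m' : ℕ) : ℕ := min d (m + m') - m'

theorem demandRank_pos (hm : 0 < m) (hd : m' < d) : 0 < demandRank d m m' := by
  unfold demandRank
  omega

theorem baselineCost_le_mul_demandRank (hK : 0 < K) :
    baselineCost K d m m' ≤ K * demandRank d m m' := by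
  rcases le_total d (m + m') with h | h
  · rw [demandRank, min_eq_left h]
    exact (min_le_left _ _).trans (Nat.le_mul_of_pos_left _ hK)
  · rw [demandRank, min_eq_right h, Nat.add_sub_cancel]
    exact min_le_right _ _

theorem baselineCost_le_sub_mul_demandRank :
    baselineCost K d m m' ≤ (d + 1 - min d (m + m')) * demandRank d m m' := by
  rcases le_total d (m + m') with h | h
  · rw [demandRank, min_eq_left h, Nat.add_sub_cancel_left, one_mul]
    exact min_le_left _ _
  · obtain ⟨t, rfl⟩ := Nat.exists_eq_add_of_le h
    rw [demandRank, min_eq_right h, Nat.add_sub_cancel, add_assoc (m + m'),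
      Nat.add_sub_cancel_left]
    rcases m.eq_zero_or_pos with rfl | hm
    · exact min_le_right _ _
    · refine (min_le_left _ _).trans ?_
      have : t ≤ t * m := Nat.le_mul_of_pos_right t hm
      rw [add_one_mul]
      omega

theorem add_mul_demandRank_le : (m + m') * demandRank d m m' ≤ min d (m + m') * m := by
  rcases le_total (m + m') d with h | h
  · rw [demandRank, min_eq_right h, Nat.add_sub_cancel]
  · rw [demandRank, min_eq_left h]
    rcases le_total d m' with hd | hd
    · simp [Nat.sub_eq_zero_of_le hd]
    · obtain ⟨t, rfl⟩ := Nat.exists_eq_add_of_le hd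
      rw [Nat.add_sub_cancel_left]
      nlinarith

theorem four_mul_sub_mul_le {a : ℕ} (ha : a ≤ d) : 4 * ((d + 1 - a) * a) ≤ (d + 4) * d := by
  have hsq := four_mul_le_sq_add (d + 1 - a) a
  rw [Nat.sub_add_cancel (by omega)] at hsq
  rcases d.eq_zero_or_pos with rfl | hd
  · simp [Nat.le_zero.1 ha]
  · linarith

theorem mul_div_half_le_four_mul_baselineCost :
    (d * (d / (((d - 1) / 2 : ℕ) + 1)) : ℝ) ≤ 4 * baselineCost d d 1 ((d - 1) / 2) := by
  rw [mul_div_assoc', div_le_iff₀ (by positivity), baselineCost, mul_one,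
    min_eq_left (Nat.sub_le _ _)]
  have := Nat.mul_le_mul (show d ≤ 2 * (d - (d - 1) / 2) by omega)
    (show d ≤ 2 * ((d - 1) / 2 + 1) by omega)
  exact_mod_cast (show d * d ≤ 4 * (d - (d - 1) / 2) * ((d - 1) / 2 + 1) by linarith)

theorem baselineCost_succ_mul_self (r : ℕ) :
    baselineCost (r + 1) ((r + 1) * r + 1) 1 (r * r) = r + 1 := by
  rw [baselineCost, add_one_mul, add_assoc, Nat.add_sub_cancel_left, mul_one, min_self]

theorem baselineRate_eq : baselineRate K d m m' = (baselineCost K d m m' : ℝ≥0∞)⁻¹ := by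
  rw [baselineRate, baselineCost, one_div, one_div, Nat.mono_cast.map_min, Nat.cast_mul]
  exact ENNReal.inv_strictAnti.antitone.map_min.symm

theorem one_div_div_baselineRate {Δ : ℝ} (hΔ : 0 < Δ) :
    1 / ENNReal.ofReal Δ / baselineRate K d m m' =
      ENNReal.ofReal (baselineCost K d m m' / Δ) := by
  rw [baselineRate_eq, div_eq_mul_inv _ (_⁻¹), inv_inv, one_div, mul_comm,
    ENNReal.ofReal_div_of_pos hΔ, ENNReal.ofReal_natCast, div_eq_mul_inv]

theorem envelopeRate_eq (hm : 0 < m) (hd : 0 < d) :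
    envelopeRate d m m' = 1 / ENNReal.ofReal (m * d / (m + m')) := by
  have hmul : (0 : ℝ) < m * d := by positivity
  have hadd : (m : ℝ) + m' = (m + m' : ℕ) := (Nat.cast_add m m').symm
  rw [envelopeRate, one_div, ← ENNReal.ofReal_inv_of_pos (by positivity), inv_div,
    ENNReal.ofReal_div_of_pos hmul, hadd, ENNReal.ofReal_mul m.cast_nonneg]
  simp only [ENNReal.ofReal_natCast]
  rw [Nat.cast_add]

theorem one_div_div_baselineRate_le {Δ B : ℝ} (hΔ : 0 < Δ) (h : baselineCost K d m m' ≤ B * Δ) :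
    1 / ENNReal.ofReal Δ / baselineRate K d m m' ≤ ENNReal.ofReal B := by
  rw [one_div_div_baselineRate hΔ]
  exact ENNReal.ofReal_le_ofReal ((div_le_iff₀ hΔ).2 h)

theorem ofReal_div_four_le_one_div_div_baselineRate {Δ : ℝ} (hΔ : 0 < Δ)
    (h : d * Δ ≤ 4 * baselineCost K d m m') :
    ENNReal.ofReal (d / 4) ≤ 1 / ENNReal.ofReal Δ / baselineRate K d m m' := by
  rw [one_div_div_baselineRate hΔ]
  refine ENNReal.ofReal_le_ofReal ((div_le_div_iff₀ four_pos hΔ).2 ?_)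
  rwa [mul_comm (_ : ℝ) 4]

theorem baselineCost_le_mul_of_demandRank_le {Δ : ℝ} (hK : 0 < K) (h : demandRank d m m' ≤ Δ) :
    baselineCost K d m m' ≤ K * Δ :=
  calc (baselineCost K d m m' : ℝ) ≤ K * demandRank d m m' := by
        exact_mod_cast baselineCost_le_mul_demandRank hK
    _ ≤ K * Δ := by gcongr

theorem baselineCost_le_mul_of_mul_demandRank_le {Δ : ℝ} (hm : 0 < m) (hd : 0 < d)
    (h : d * demandRank d m m' ≤ (min d (m + m') : ℕ) * Δ) :
    baselineCost K d m m' ≤ (d / 4 + 1) * Δ := by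
  set a := min d (m + m')
  have ha_pos : 0 < a := by omega
  have hle : 4 * (a * baselineCost K d m m') ≤ (d + 4) * (d * demandRank d m m') :=
    calc 4 * (a * baselineCost K d m m')
        ≤ 4 * (a * ((d + 1 - a) * demandRank d m m')) := by
          gcongr
          exact baselineCost_le_sub_mul_demandRank
      _ = 4 * ((d + 1 - a) * a) * demandRank d m m' := by ring
      _ ≤ (d + 4) * d * demandRank d m m' := by
          refine Nat.mul_le_mul_right _ ?_
          exact four_mul_sub_mul_le (min_le_left _ _)
      _ = (d + 4) * (d * demandRank d m m') := by ring
  refine le_of_mul_le_mul_left ?_ (Nat.cast_pos (α := ℝ).2 ha_pos)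
  have hle' : (4 * (a * baselineCost K d m m') : ℝ) ≤ (d + 4) * (d * demandRank d m m') := by
    exact_mod_cast hle
  nlinarith

theorem mul_demandRank_le_mul_envelope (hm : 0 < m) (m' : ℕ) :
    (d * demandRank d m m' : ℝ) ≤ (min d (m + m') : ℕ) * (m * d / (m + m')) := by
  have hadd : (0 : ℝ) < m + m' := by positivity
  rw [mul_div_assoc', le_div_iff₀ hadd]
  exact_mod_cast (show d * demandRank d m m' * (m + m') ≤ min d (m + m') * (m * d) by
    have := Nat.mul_le_mul_left d (add_mul_demandRank_le (d := d) (m := m) (m' := m'))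
    linarith)

end Baseline

section GenericCost

variable {p : ℕ} [Fact p.Prime] {K d m m' : ℕ} {Δ : ℝ}

theorem IsGenericCost.mul_demandRank_le (hΔ : IsGenericCost p K d m m' Δ) (hd : m' ≤ d) {k c : ℕ}
    (hk : k ≤ K) (hc : k * min d (m + m') ≤ c * d) : k * demandRank d m m' ≤ c * Δ := by
  rw [demandRank, Nat.cast_sub (by omega)]
  exact hΔ.mul_min_sub_le hk hc

theorem IsGenericCost.demandRank_le (hΔ : IsGenericCost p K d m m' Δ) (hK : 0 < K)
    (hd : m' ≤ d) : demandRank d m m' ≤ Δ := by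
  simpa using hΔ.mul_demandRank_le hd (k := 1) (c := 1) hK
    (Nat.mul_le_mul_left 1 (min_le_left _ _))

theorem IsGenericCost.pos (hΔ : IsGenericCost p K d m m' Δ) (hK : 0 < K) (hm : 0 < m)
    (hd : m' < d) : 0 < Δ :=
  (Nat.cast_pos.2 (demandRank_pos hm hd)).trans_le (hΔ.demandRank_le hK hd.le)

theorem IsGenericCost.mul_demandRank_le_of_manyUsers (hΔ : IsGenericCost p K d m m' Δ)
    (hK : 0 < K) (hd : m' < d) (hKd : ManyUsers K d m m') :
    d * demandRank d m m' ≤ (min d (m + m') : ℕ) * Δ := by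
  rcases le_total d (m + m') with h | h
  · rw [min_eq_left h]
    gcongr
    exact hΔ.demandRank_le hK hd.le
  · set g := d.gcd (m + m')
    have hdvd : g ∣ d := Nat.gcd_dvd_left _ _
    have hdvd' : g ∣ m + m' := Nat.gcd_dvd_right _ _
    have hΔ' := hΔ.mul_demandRank_le hd.le (k := d / g) (c := (m + m') / g) hKd (by
      rw [min_eq_right h, Nat.div_mul_right_comm hdvd, Nat.div_mul_right_comm hdvd', mul_comm])
    calc (d * demandRank d m m' : ℝ)
        = (d / g * g : ℕ) * demandRank d m m' := by rw [Nat.div_mul_cancel hdvd]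
      _ = g * ((d / g : ℕ) * demandRank d m m') := by rw [Nat.cast_mul]; ring
      _ ≤ g * (((m + m') / g : ℕ) * Δ) := by gcongr
      _ = ((m + m') / g * g : ℕ) * Δ := by rw [Nat.cast_mul]; ring
      _ = (min d (m + m') : ℕ) * Δ := by rw [Nat.div_mul_cancel hdvd', min_eq_right h]

theorem IsGenericCost.baselineCost_le_mul (hΔ : IsGenericCost p K d m m' Δ) (hK : 0 < K)
    (hm : 0 < m) (hd : m' < d) {B : ℝ}
    (hB : ∀ k x : ℕ, 0 < k → k + x ≤ d + 1 →
      ∃ i c : ℕ, 0 < i ∧ i ≤ k ∧ i * x ≤ c * d ∧ (k * c : ℝ) ≤ B * i) :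
    baselineCost K d m m' ≤ B * Δ := by
  obtain ⟨i, c, hi, hik, hic, hB⟩ := hB (min K (d + 1 - min d (m + m'))) (min d (m + m'))
    (by omega) (by omega)
  set k := min K (d + 1 - min d (m + m'))
  have hΔ_pos := hΔ.pos hK hm hd
  have hbase : baselineCost K d m m' ≤ k * demandRank d m m' := by
    rw [min_mul_of_nonneg _ _ (Nat.zero_le _)]
    exact le_min (baselineCost_le_mul_demandRank hK) baselineCost_le_sub_mul_demandRank
  refine le_of_mul_le_mul_left ?_ (Nat.cast_pos (α := ℝ).2 hi)
  calc (i * baselineCost K d m m' : ℝ)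
      ≤ i * (k * demandRank d m m') := by gcongr; exact_mod_cast hbase
    _ = k * (i * demandRank d m m') := by ring
    _ ≤ k * (c * Δ) := by
        refine mul_le_mul_of_nonneg_left ?_ k.cast_nonneg
        exact hΔ.mul_demandRank_le hd.le (hik.trans (min_le_left _ _)) hic
    _ = (k * c) * Δ := by ring
    _ ≤ (B * i) * Δ := by gcongr
    _ = i * (B * Δ) := by ring

end GenericCost

section Extremal

variable {p : ℕ} [Fact p.Prime] {K d m m' : ℕ} {C : ℝ≥0∞}

theorem ofReal_div_four (d : ℕ) : ENNReal.ofReal (d / 4) = (d : ℝ≥0∞) / 4 := by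
  rw [ENNReal.ofReal_div_of_pos (by norm_num), ENNReal.ofReal_natCast, ENNReal.ofReal_ofNat]

theorem ofReal_div_four_add_one (d : ℕ) : ENNReal.ofReal (d / 4 + 1) = (d : ℝ≥0∞) / 4 + 1 := by
  rw [ENNReal.ofReal_add (by positivity) zero_le_one, ofReal_div_four, ENNReal.ofReal_one]

theorem IsGenericCapacity.div_baselineRate_le (hC : IsGenericCapacity p K d m m' C) (hK : 0 < K)
    (hm : 0 < m) (hd : m' < d) {B : ℝ}
    (hB : ∀ Δ, IsGenericCost p K d m m' Δ → baselineCost K d m m' ≤ B * Δ) :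
    C / baselineRate K d m m' ≤ ENNReal.ofReal B := by
  obtain ⟨Δ, hΔ, rfl⟩ := hC
  exact one_div_div_baselineRate_le (hΔ.pos hK hm hd) (hB Δ hΔ)

theorem gainUsers_le (hK : 0 < K) : gainUsers K ≤ K := by
  refine sSup_le ?_
  rintro _ ⟨p, _, d, m, m', C, hm, hd, hC, rfl⟩
  rw [← ENNReal.ofReal_natCast]
  exact hC.div_baselineRate_le hK hm hd fun Δ hΔ =>
    baselineCost_le_mul_of_demandRank_le hK (hΔ.demandRank_le hK hd.le)

theorem gainDimManyUsers_le (d : ℕ) : gainDimManyUsers d ≤ (d : ℝ≥0∞) / 4 + 1 := by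
  refine sSup_le ?_
  rintro _ ⟨p, _, K, m, m', C, hK, hm, hd, hKd, hC, rfl⟩
  rw [← ofReal_div_four_add_one]
  exact hC.div_baselineRate_le hK hm hd fun Δ hΔ =>
    baselineCost_le_mul_of_mul_demandRank_le hm (m'.zero_le.trans_lt hd)
      (hΔ.mul_demandRank_le_of_manyUsers hK hd hKd)

theorem gainDimManyUsers_le_gainDim (d : ℕ) : gainDimManyUsers d ≤ gainDim d := by
  refine sSup_le_sSup ?_
  rintro _ ⟨p, hp, K, m, m', C, hK, hm, hd, -, hC, rfl⟩
  exact ⟨p, hp, K, m, m', C, hK, hm, hd, hC, rfl⟩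

theorem gainDim_le_ofReal {B : ℝ}
    (hB : ∀ k x : ℕ, 0 < k → k + x ≤ d + 1 →
      ∃ i c : ℕ, 0 < i ∧ i ≤ k ∧ i * x ≤ c * d ∧ (k * c : ℝ) ≤ B * i) :
    gainDim d ≤ ENNReal.ofReal B := by
  refine sSup_le ?_
  rintro _ ⟨p, _, K, m, m', C, hK, hm, hd, hC, rfl⟩
  exact hC.div_baselineRate_le hK hm hd fun Δ hΔ => hΔ.baselineCost_le_mul hK hm hd hB

theorem four_mul_le_sq_of_add_le {k x s : ℕ} (h : k + x ≤ s) : 4 * (k * x) ≤ s ^ 2 := by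
  rw [← mul_assoc]
  exact (four_mul_le_sq_add k x).trans (Nat.pow_le_pow_left h 2)

theorem gainDim_le_natCast {c : ℕ} (hc : (d + 1) ^ 2 / 4 ≤ c * d) : gainDim d ≤ c := by
  rw [← ENNReal.ofReal_natCast]
  refine gainDim_le_ofReal fun k x hk hkx => ⟨k, c, hk, le_rfl, le_trans ?_ hc, ?_⟩
  · rw [Nat.le_div_iff_mul_le four_pos, mul_comm]
    exact four_mul_le_sq_of_add_le hkx
  · rw [mul_comm]

theorem four_mul_add_seven_le_three_mul {j k x : ℕ} (hj : 2 ≤ j) (hkx : k + x = 4 * j + 4)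
    (h : (j + 1) * (4 * j + 3) < k * x) : 4 * j + 7 ≤ 3 * k := by
  by_contra! hk
  obtain rfl | hj := hj.eq_or_lt
  · have : k ≤ 4 := by omega
    obtain rfl : x = 12 - k := by omega
    interval_cases k <;> omega
  · obtain ⟨t, rfl⟩ : ∃ t : ℕ, j = t + 3 := ⟨j - 3, by omega⟩
    zify at hkx h
    have hx := eq_sub_of_add_eq' hkx
    rw [hx] at h
    nlinarith [mul_nonneg (show (0 : ℤ) ≤ 4 * (t + 3) + 6 - 3 * k by omega)
      (show (0 : ℤ) ≤ 8 * (t + 3) + 6 - 3 * k by omega)]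

theorem gainDim_four_mul_add_three_le {j : ℕ} (hj : 2 ≤ j) :
    gainDim (4 * j + 3) ≤ ENNReal.ofReal (j + 7 / 4) := by
  refine gainDim_le_ofReal fun k x hk hkx => ?_
  rcases le_or_gt (k * x) ((j + 1) * (4 * j + 3)) with h | h
  · exact ⟨k, j + 1, hk, le_rfl, h, by push_cast; nlinarith⟩
  -- Only nearly equal `k` and `x` with `k + x = d + 1` are left, and there dropping one of the `k`
  -- users loses no more than a factor `k / (k - 1)`.
  · have hkx' : k + x = 4 * j + 4 := by
      refine hkx.antisymm (not_lt.1 fun hlt => ?_)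
      have := four_mul_le_sq_of_add_le (s := 4 * j + 3) (Nat.le_of_lt_succ hlt)
      nlinarith
    have hk' := four_mul_add_seven_le_three_mul hj hkx' h
    obtain ⟨i, rfl⟩ : ∃ i, k = i + 1 := ⟨k - 1, by omega⟩
    refine ⟨i, j + 1, by omega, i.le_succ, ?_, ?_⟩
    · have := four_mul_le_sq_of_add_le (k := i) (x := x) (s := 4 * j + 3) (by omega)
      nlinarith
    · have : (4 * j + 4 : ℝ) ≤ 3 * i := by exact_mod_cast (show 4 * j + 4 ≤ 3 * i by omega)
      push_cast
      linarith

theorem gainDim_le (h3 : d ≠ 3) (h7 : d ≠ 7) : gainDim d ≤ (d : ℝ≥0∞) / 4 + 1 := by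
  rw [← ofReal_div_four_add_one]
  obtain ⟨j, hj⟩ : ∃ j, j = d / 4 := ⟨_, rfl⟩
  rcases eq_or_ne (d % 4) 3 with hmod | hmod
  · obtain rfl : d = 4 * j + 3 := by omega
    refine (gainDim_four_mul_add_three_le (by omega)).trans_eq ?_
    push_cast
    ring_nf
  · refine (gainDim_le_natCast (c := d / 4 + 1) ?_).trans ?_
    · obtain ⟨i, hi⟩ : ∃ i, i = d % 4 := ⟨_, rfl⟩
      obtain rfl : d = 4 * j + i := by omega
      rw [← hj, Nat.div_le_iff_le_mul_add_pred four_pos]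
      change _ ≤ 4 * _ + 3
      have : i < 3 := by omega
      interval_cases i <;> nlinarith
    · rw [← ENNReal.ofReal_natCast]
      refine ENNReal.ofReal_le_ofReal ?_
      push_cast
      gcongr
      exact Nat.cast_div_le

theorem natCast_eq_one_div_div_baselineRate (r : ℕ) : ((r + 1 : ℕ) : ℝ≥0∞) =
    1 / ENNReal.ofReal 1 / baselineRate (r + 1) ((r + 1) * r + 1) 1 (r * r) := by
  rw [one_div_div_baselineRate one_pos, baselineCost_succ_mul_self, div_one,
    ENNReal.ofReal_natCast]

theorem natCast_le_gainDim (r : ℕ) : ((r + 1 : ℕ) : ℝ≥0∞) ≤ gainDim ((r + 1) * r + 1) := by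
  have : Fact (Nat.Prime 2) := ⟨Nat.prime_two⟩
  exact le_sSup ⟨2, this, r + 1, 1, r * r, _, r.succ_pos, one_pos, by nlinarith,
    ⟨1, isGenericCost_one 2 r r, rfl⟩, natCast_eq_one_div_div_baselineRate r⟩

theorem gainDim_three : gainDim 3 = 2 := by
  refine le_antisymm ?_ (natCast_le_gainDim 1)
  exact gainDim_le_natCast (c := 2) (by norm_num)

theorem gainDim_seven : gainDim 7 = 3 := by
  refine le_antisymm ?_ (natCast_le_gainDim 2)
  exact gainDim_le_natCast (c := 3) (by norm_num)

theorem gainUsers_eq (hK : 0 < K) : gainUsers K = K := by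
  refine (gainUsers_le hK).antisymm ?_
  have : Fact (Nat.Prime 2) := ⟨Nat.prime_two⟩
  obtain ⟨r, rfl⟩ := Nat.exists_eq_add_one.2 hK
  exact le_sSup ⟨2, this, (r + 1) * r + 1, 1, r * r, _, one_pos, by nlinarith,
    ⟨1, isGenericCost_one 2 r r, rfl⟩, natCast_eq_one_div_div_baselineRate r⟩

theorem div_four_le_gainDimManyUsers (hd : 0 < d) : (d : ℝ≥0∞) / 4 ≤ gainDimManyUsers d := by
  have : Fact (Nat.Prime 2) := ⟨Nat.prime_two⟩
  refine le_trans ?_ (le_sSup ⟨2, this, d, 1, (d - 1) / 2, _, hd, one_pos, by omega,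
    Nat.div_le_self _ _, ⟨_, isGenericCost_of_le 2 (by omega) le_rfl, rfl⟩, rfl⟩)
  rw [← ofReal_div_four]
  exact ofReal_div_four_le_one_div_div_baselineRate (by positivity)
    mul_div_half_le_four_mul_baselineCost

theorem div_four_le_envelopeGainDim (hd : 0 < d) : (d : ℝ≥0∞) / 4 ≤ envelopeGainDim d := by
  refine le_trans ?_ (le_sSup ⟨d, 1, (d - 1) / 2, hd, one_pos, by omega, rfl⟩)
  rw [envelopeRate_eq one_pos hd, ← ofReal_div_four]
  refine ofReal_div_four_le_one_div_div_baselineRate (by positivity) ?_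
  rw [Nat.cast_one, one_mul, add_comm (1 : ℝ)]
  exact mul_div_half_le_four_mul_baselineCost

theorem envelopeGainDim_le (d : ℕ) : envelopeGainDim d ≤ (d : ℝ≥0∞) / 4 + 1 := by
  refine sSup_le ?_
  rintro _ ⟨K, m, m', -, hm, hd, rfl⟩
  have hd' : 0 < d := m'.zero_le.trans_lt hd
  rw [envelopeRate_eq hm hd', ← ofReal_div_four_add_one]
  exact one_div_div_baselineRate_le (by positivity)
    (baselineCost_le_mul_of_mul_demandRank_le hm hd' (mul_demandRank_le_mul_envelope hm m'))

theorem envelopeGainUsers_le (hK : 0 < K) : envelopeGainUsers K ≤ K := by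
  refine sSup_le ?_
  rintro _ ⟨d, m, m', hm, hd, rfl⟩
  have hd' : 0 < d := m'.zero_le.trans_lt hd
  rw [envelopeRate_eq hm hd', ← ENNReal.ofReal_natCast]
  refine one_div_div_baselineRate_le (by positivity)
    (baselineCost_le_mul_of_demandRank_le hK (le_of_mul_le_mul_left ?_ (Nat.cast_pos.2 hd')))
  refine (mul_demandRank_le_mul_envelope hm m').trans ?_
  gcongr
  exact min_le_left _ _

theorem le_envelopeGainUsers (hK : 0 < K) : (K : ℝ≥0∞) ≤ envelopeGainUsers K := by
  have hlim : Tendsto (fun j : ℕ => (K + K * j : ℝ) / (K + 1 * j)) atTop (𝓝 (K / 1)) :=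
    tendsto_add_mul_div_add_mul_atTop_nhds _ _ _ one_ne_zero
  rw [div_one] at hlim
  have hlim' := (ENNReal.continuous_ofReal.tendsto (K : ℝ)).comp hlim
  rw [ENNReal.ofReal_natCast] at hlim'
  refine le_of_tendsto' hlim' fun j => le_sSup ⟨K + j, 1, j, one_pos, by omega, ?_⟩
  rw [envelopeRate_eq one_pos (by omega), one_div_div_baselineRate (by positivity),
    baselineCost, Nat.add_sub_cancel, mul_one, min_self]
  simp only [Function.comp_apply]
  congr 1
  push_cast
  field_simp

end Extremal

end

end LCBC

theorem mainTheorem6 :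
    (∀ K : ℕ, 0 < K → LCBC.gainUsers K = (K : ℝ≥0∞) ∧ LCBC.envelopeGainUsers K = (K : ℝ≥0∞)) ∧
    (∀ d : ℕ, 0 < d →
      (d : ℝ≥0∞) / 4 ≤ LCBC.gainDim d ∧
      (d ≠ 3 → d ≠ 7 → LCBC.gainDim d ≤ (d : ℝ≥0∞) / 4 + 1) ∧
      LCBC.gainDimManyUsers d ∈ Set.Icc ((d : ℝ≥0∞) / 4) ((d : ℝ≥0∞) / 4 + 1) ∧
      LCBC.envelopeGainDim d ∈ Set.Icc ((d : ℝ≥0∞) / 4) ((d : ℝ≥0∞) / 4 + 1)) ∧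
    LCBC.gainDim 3 = 2 ∧ LCBC.gainDim 7 = 3 :=
  ⟨fun _ hK => ⟨LCBC.gainUsers_eq hK,
      (LCBC.envelopeGainUsers_le hK).antisymm (LCBC.le_envelopeGainUsers hK)⟩,
    fun d hd => ⟨(LCBC.div_four_le_gainDimManyUsers hd).trans (LCBC.gainDimManyUsers_le_gainDim d),
      LCBC.gainDim_le, ⟨LCBC.div_four_le_gainDimManyUsers hd, LCBC.gainDimManyUsers_le d⟩,
      ⟨LCBC.div_four_le_envelopeGainDim hd, LCBC.envelopeGainDim_le d⟩⟩,
    LCBC.gainDim_three, LCBC.gainDim_seven⟩
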